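/- Let $\Lambda(X_1|\cdots|X_r)=\Lambda(X_1)\otimes\cdots\otimes\Lambda(X_r)$ be the ring of multi-symmetric functions over $\mathbb{Q}$ in $r$ infinite alphabets $X_i=x_{i,1}+x_{i,2}+\cdots$, i.e. the polynomial ring in the power sums $p_k(X_i)=\sum_a x_{i,a}^k$ ($1\le i\le r$, $k\ge 1$). The key polynomials $\mathcal{K}_\alpha(x_1,\dots,x_n)$, $\alpha\in\mathbb{Z}_{\ge0}^n$, are the unique polynomials with $\mathcal{K}_\alpha=x^\alpha$ if $\alpha_1\ge\cdots\ge\alpha_n$, and $\mathcal{K}_{s_a(\alpha)}=\xi_a(\mathcal{K}_\alpha)$ whenever $\alpha_a>\alpha_{a+1}$, where $s_a$ exchanges the entries (or variables) $a$ and $a+1$ and $\xi_a(f)=\frac{x_a f-x_{a+1}s_a(f)}{x_a-x_{a+1}}$. For partitions $\lambda^{(1)},\dots,\lambda^{(r)}$, the multi-symmetric Schur function is the limit of formal power series $$\mathcal{S}_{(\lambda^{(1)}|\cdots|\lambda^{(r)})}(X_1|\cdots|X_r)=\lim_{n_1,\dots,n_r\to\infty}\mathcal{K}_{(0^{n_1-\ell(\lambda^{(1)})}*\mathrm{rev}(\lambda^{(1)}))*\cdots*(0^{n_r-\ell(\lambda^{(r)})}*\mathrm{rev}(\lambda^{(r)}))}(x_{1,1},\dots,x_{1,n_1},\dots,x_{r,1},\dots,x_{r,n_r}),$$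 where $*$ is concatenation and $\mathrm{rev}(\lambda)$ lists the parts of $\lambda$ in weakly increasing order. Let $z$ be a further variable, let $\Omega(zX)=\sum_\lambda z^{|\lambda|}m_\lambda(X)$ (sum over all partitions, $m_\lambda$ the monomial symmetric functions), and let $\langle z^0\rangle$ denote the coefficient of $z^0$ in a Laurent series in $z$. For $f\in\Lambda(X_1|\cdots|X_r)$, the plethysm $f(X_1|\cdots|X_i+z^{-1}|X_{i+1}-z^{-1}|\cdots|X_r)$ is the image of $f$ under the ring homomorphism that sends $p_k(X_i)\mapsto p_k(X_i)+z^{-k}$ and $p_k(X_{i+1})\mapsto p_k(X_{i+1})-z^{-k}$ and fixes $p_k(X_l)$ for $l\ne i,i+1$. Then for all partitions $\lambda^{(1)},\dots,\lambda^{(r)}$ and every $1\le i\le r-1$ with $\lambda^{(i)}\neq\emptyset$, with $\lambda^{(i)}_1$ the largest part of $\lambda^{(i)}$, the limits defining the two multi-symmetric Schur functions below exist, $\mathcal{S}_{(\lambda^{(1)}|\cdots|\lambda^{(r)})}$ lies in $\Lambda(X_1|\cdots|X_r)$, and $$\mathcal{S}_{(\lambda^{(1)}|\cdots|\lambda^{(i)}\setminus\{\lambda^{(i)}_1\}|\lambda^{(i+1)}\cup\{\lambda^{(i)}_1\}|\cdots|\lambda^{(r)})}=\langle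 z^0\rangle\,\mathcal{S}_{(\lambda^{(1)}|\cdots|\lambda^{(r)})}(X_1|\cdots|X_i+z^{-1}|X_{i+1}-z^{-1}|\cdots|X_r)\,\Omega(zX_{i+1}).$$ -/

import Mathlib

namespace MultiSchur

open MvPolynomial

/-- The numerator `x_a f - x_b s_{ab} f` is divisible by `x_a - x_b`. -/
theorem isobaric_exists {σ : Type*} [DecidableEq σ] (a b : σ) (f : MvPolynomial σ ℚ) :
    ∃ g : MvPolynomial σ ℚ,
      (X a - X b) * g = X a * f - X b * rename (Equiv.swap a b) f := by
  have key : (X a - X b : MvPolynomial σ ℚ) ∣ f - rename (Equiv.swap a b) f := by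
    rw [← Ideal.mem_span_singleton, ← Ideal.Quotient.mk_eq_mk_iff_sub_mem]
    have hab : Ideal.Quotient.mk (Ideal.span {(X a - X b : MvPolynomial σ ℚ)}) (X a)
        = Ideal.Quotient.mk (Ideal.span {(X a - X b : MvPolynomial σ ℚ)}) (X b) :=
      (Ideal.Quotient.mk_eq_mk_iff_sub_mem _ _).2 (Ideal.mem_span_singleton_self _)
    have : (Ideal.Quotient.mkₐ ℚ (Ideal.span {(X a - X b : MvPolynomial σ ℚ)})) =
        (Ideal.Quotient.mkₐ ℚ (Ideal.span {(X a - X b : MvPolynomial σ ℚ)})).comp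
          (rename (Equiv.swap a b)) := by
      ext c
      simp only [AlgHom.comp_apply, rename_X, Ideal.Quotient.mkₐ_eq_mk]
      rcases eq_or_ne c a with rfl | hca
      · rw [Equiv.swap_apply_left, hab]
      rcases eq_or_ne c b with rfl | hcb
      · rw [Equiv.swap_apply_right, hab]
      · rw [Equiv.swap_apply_of_ne_of_ne hca hcb]
    exact DFunLike.congr_fun this f
  obtain ⟨q, hq⟩ := key
  exact ⟨f + X b * q, by linear_combination (-X b) * hq⟩

/-- The isobaric divided difference operator
`ξ_{a,b} f = (x_a f - x_b f(x_a ↔ x_b)) / (x_a - x_b)`; for `a ≠ b` the quotient is unique. -/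
noncomputable def isobaric {σ : Type*} [DecidableEq σ] (a b : σ) (f : MvPolynomial σ ℚ) :
    MvPolynomial σ ℚ :=
  (isobaric_exists a b f).choose

theorem isobaric_spec {σ : Type*} [DecidableEq σ] (a b : σ) (f : MvPolynomial σ ℚ) :
    (X a - X b) * isobaric a b f = X a * f - X b * rename (Equiv.swap a b) f :=
  (isobaric_exists a b f).choose_spec

theorem X_sub_ne {σ : Type*} {a b : σ} (h : a ≠ b) : (X a - X b : MvPolynomial σ ℚ) ≠ 0 :=
  sub_ne_zero.2 fun e => h (X_injective e)

theorem weight_swap_lt {n : ℕ} (α : Fin n → ℕ) (a b : Fin n) (hab : a < b) (h : α a < α b) :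
    ∑ i : Fin n, (i : ℕ) * (α ∘ Equiv.swap a b) i < ∑ i : Fin n, (i : ℕ) * α i := by
  have hne : a ≠ b := hab.ne
  have e : ∀ β : Fin n → ℕ, ∑ i : Fin n, (i : ℕ) * β i =
      (a : ℕ) * β a + ((b : ℕ) * β b + ∑ i ∈ (Finset.univ.erase a).erase b, (i : ℕ) * β i) := by
    intro β
    rw [Finset.add_sum_erase _ (fun i : Fin n => (i : ℕ) * β i) (by simp [hne.symm]),
      Finset.add_sum_erase _ (fun i : Fin n => (i : ℕ) * β i) (Finset.mem_univ a)]
  rw [e, e α]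
  have h3 : ∑ i ∈ (Finset.univ.erase a).erase b, (i : ℕ) * (α ∘ Equiv.swap a b) i =
      ∑ i ∈ (Finset.univ.erase a).erase b, (i : ℕ) * α i := by
    refine Finset.sum_congr rfl fun i hi => ?_
    simp only [Finset.mem_erase, Finset.mem_univ, and_true] at hi
    rw [Function.comp_apply, Equiv.swap_apply_of_ne_of_ne hi.2 hi.1]
  rw [h3]
  simp only [Function.comp_apply, Equiv.swap_apply_left, Equiv.swap_apply_right]
  have : (a : ℕ) < b := hab
  nlinarith

open Classical in
/-- The key polynomial `K_α(x_1, …, x_n)`: the monomial `x^α` if `α` is weakly decreasing, and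
`ξ_{a,a+1} K_{s_a α}` for an ascent `α_a < α_{a+1}` otherwise. The value does not depend on the
ascents used: `keyPoly_isKeyFamily` and `isKeyFamily_unique` below show that these polynomials are
the unique family with the two defining properties of key polynomials. -/
noncomputable def keyPoly {n : ℕ} (α : Fin n → ℕ) : MvPolynomial (Fin n) ℚ :=
  if h : ∃ p : Fin n × Fin n, (p.2 : ℕ) = p.1 + 1 ∧ α p.1 < α p.2 then
    isobaric h.choose.1 h.choose.2 (keyPoly (α ∘ Equiv.swap h.choose.1 h.choose.2))
  else monomial (Finsupp.equivFunOnFinite.symm α) 1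
termination_by ∑ i : Fin n, (i : ℕ) * α i
decreasing_by
  exact weight_swap_lt α _ _ (by rw [Fin.lt_def, h.choose_spec.1]; omega) h.choose_spec.2

/-- The defining properties of the key polynomials in `n` variables. -/
structure IsKeyFamily {n : ℕ} (K : (Fin n → ℕ) → MvPolynomial (Fin n) ℚ) : Prop where
  antitone : ∀ α, Antitone α → K α = monomial (Finsupp.equivFunOnFinite.symm α) 1
  step : ∀ (α : Fin n → ℕ) (a b : Fin n), (b : ℕ) = a + 1 → α b < α a →
    K (α ∘ Equiv.swap a b) = isobaric a b (K α)

theorem keyPoly_of_antitone {n : ℕ} (α : Fin n → ℕ) (h : Antitone α) :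
    keyPoly α = monomial (Finsupp.equivFunOnFinite.symm α) 1 := by
  rw [keyPoly, dif_neg]
  rintro ⟨p, hp, h1⟩
  exact absurd (h (Fin.le_def.2 (by omega))) (not_le.2 h1)

theorem exists_ascent {n : ℕ} (α : Fin n → ℕ) (h : ¬ Antitone α) :
    ∃ a b : Fin n, (b : ℕ) = a + 1 ∧ α a < α b := by
  by_contra hc
  push Not at hc
  apply h
  rcases n with _ | n
  · intro a; exact a.elim0
  · rw [Fin.antitone_iff_succ_le]
    intro i
    exact hc _ _ (by simp)

/-- The defining properties determine the key polynomials. -/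
theorem isKeyFamily_unique {n : ℕ} {K L : (Fin n → ℕ) → MvPolynomial (Fin n) ℚ}
    (hK : IsKeyFamily K) (hL : IsKeyFamily L) (α : Fin n → ℕ) : K α = L α := by
  by_cases h : Antitone α
  · rw [hK.antitone α h, hL.antitone α h]
  · obtain ⟨a, b, hab, h1⟩ := exists_ascent α h
    have e : α = (α ∘ Equiv.swap a b) ∘ Equiv.swap a b := by
      ext x; simp
    have ih := isKeyFamily_unique hK hL (α ∘ Equiv.swap a b)
    rw [e, hK.step _ _ _ hab (by simpa using h1), hL.step _ _ _ hab (by simpa using h1), ih]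
termination_by ∑ i : Fin n, (i : ℕ) * α i
decreasing_by exact weight_swap_lt α _ _ (by rw [Fin.lt_def]; omega) h1

theorem swap_mul_comm {σ : Type*} [DecidableEq σ] {a b c d : σ}
    (hac : a ≠ c) (had : a ≠ d) (hbc : b ≠ c) (hbd : b ≠ d) :
    Equiv.swap a b * Equiv.swap c d = Equiv.swap c d * Equiv.swap a b := by
  have : Equiv.Perm.Disjoint (Equiv.swap a b) (Equiv.swap c d) := by
    intro x
    by_cases hxa : x = a
    · right; subst hxa; exact Equiv.swap_apply_of_ne_of_ne hac had
    by_cases hxb : x = b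
    · right; subst hxb; exact Equiv.swap_apply_of_ne_of_ne hbc hbd
    · left; exact Equiv.swap_apply_of_ne_of_ne hxa hxb
  exact this.commute.eq

theorem swap_braid {σ : Type*} [DecidableEq σ] {a b c : σ} (hab : a ≠ b) (hac : a ≠ c)
    (hbc : b ≠ c) : Equiv.swap b c * (Equiv.swap a b * Equiv.swap b c) =
      Equiv.swap a b * (Equiv.swap b c * Equiv.swap a b) := by
  ext x
  simp only [Equiv.Perm.mul_apply, Equiv.swap_apply_def]
  split_ifs <;> simp_all

theorem isobaric_comm {σ : Type*} [DecidableEq σ] {a b c d : σ} (hab : a ≠ b) (hcd : c ≠ d)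
    (hac : a ≠ c) (had : a ≠ d) (hbc : b ≠ c) (hbd : b ≠ d) (f : MvPolynomial σ ℚ) :
    isobaric a b (isobaric c d f) = isobaric c d (isobaric a b f) := by
  have r : ∀ (p q : Equiv.Perm σ) (g : MvPolynomial σ ℚ), rename p (rename q g) = rename (p * q : Equiv.Perm σ) g := by
    intro p q g; rw [rename_rename]; rfl
  have h1 := isobaric_spec a b (isobaric c d f)
  have h2 := isobaric_spec c d f
  have h3 := isobaric_spec c d (isobaric a b f)
  have h4 := isobaric_spec a b f
  have h5 := congrArg (rename (Equiv.swap a b)) h2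
  have h6 := congrArg (rename (Equiv.swap c d)) h4
  have hc := swap_mul_comm hac had hbc hbd
  simp only [map_mul, map_sub, rename_X, r, hc,
    Equiv.swap_apply_of_ne_of_ne hac.symm hbc.symm, Equiv.swap_apply_of_ne_of_ne had.symm hbd.symm,
    Equiv.swap_apply_of_ne_of_ne hac had, Equiv.swap_apply_of_ne_of_ne hbc hbd] at h5 h6
  apply mul_left_cancel₀ (mul_ne_zero (X_sub_ne hab) (X_sub_ne hcd))
  linear_combination (X c - X d) * h1 - (X a - X b) * h3 + X a * h2 - X c * h4 - X b * h5 + X d * h6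

theorem isobaric_braid {σ : Type*} [DecidableEq σ] {a b c : σ} (hab : a ≠ b) (hac : a ≠ c)
    (hbc : b ≠ c) (f : MvPolynomial σ ℚ) :
    isobaric a b (isobaric b c (isobaric a b f)) =
      isobaric b c (isobaric a b (isobaric b c f)) := by
  have r : ∀ (p q : Equiv.Perm σ) (g : MvPolynomial σ ℚ), rename p (rename q g) = rename (p * q : Equiv.Perm σ) g := by
    intro p q g; rw [rename_rename]; rfl
  have e3 := swap_braid hab hac hbc
  have sc : Equiv.swap a b c = c := Equiv.swap_apply_of_ne_of_ne hac.symm hbc.symm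
  have ta : Equiv.swap b c a = a := Equiv.swap_apply_of_ne_of_ne hab hac
  have h1 := isobaric_spec a b (isobaric b c (isobaric a b f))
  have h2 := isobaric_spec b c (isobaric a b f)
  have h3 := congrArg (rename (Equiv.swap a b)) h2
  have h4 := isobaric_spec a b f
  have h5 := congrArg (rename (Equiv.swap b c)) h4
  have h6 := congrArg (rename (Equiv.swap a b)) h4
  have h7 := congrArg (rename (Equiv.swap a b)) h5
  have g1 := isobaric_spec b c (isobaric a b (isobaric b c f))
  have g2 := isobaric_spec a b (isobaric b c f)
  have g3 := congrArg (rename (Equiv.swap b c)) g2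
  have g4 := isobaric_spec b c f
  have g5 := congrArg (rename (Equiv.swap a b)) g4
  have g6 := congrArg (rename (Equiv.swap b c)) g4
  have g7 := congrArg (rename (Equiv.swap b c)) g5
  simp only [map_mul, map_sub, rename_X, r, sc, ta, Equiv.swap_apply_left,
    Equiv.swap_apply_right, Equiv.swap_mul_self, Equiv.Perm.coe_one, rename_id_apply, e3]
    at h3 h5 h6 h7 g3 g5 g6 g7
  have hx := X_sub_ne hab
  have hy := X_sub_ne hbc
  have hz := X_sub_ne hac
  apply mul_left_cancel₀ (mul_ne_zero (mul_ne_zero (pow_ne_zero 2 hx) (pow_ne_zero 2 hy)) hz)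
  generalize (X a : MvPolynomial σ ℚ) = x at *
  generalize (X b : MvPolynomial σ ℚ) = y at *
  generalize (X c : MvPolynomial σ ℚ) = z at *
  linear_combination (x - y) * (y - z) ^ 2 * (x - z) * h1 + x * (x - y) * (y - z) * (x - z) * h2
    - y * (x - y) * (y - z) ^ 2 * h3 + x * y * (y - z) * (x - z) * h4
    - x * z * (x - y) * (y - z) * h5 + x * y * (y - z) ^ 2 * h6 + y * z * (x - y) * (y - z) * h7
    - (x - y) ^ 2 * (y - z) * (x - z) * g1 - y * (x - y) * (x - z) * (y - z) * g2
    + z * (x - y) ^ 2 * (y - z) * g3 - x * y * (x - y) * (x - z) * g4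
    + y ^ 2 * (x - y) * (y - z) * g5 - z * x * (x - y) ^ 2 * g6 - z ^ 2 * (x - y) * (y - z) * g7

theorem keyPoly_of_ascent {n : ℕ} (β : Fin n → ℕ) (a b : Fin n) (hab : (b : ℕ) = a + 1)
    (h : β a < β b) : keyPoly β = isobaric a b (keyPoly (β ∘ Equiv.swap a b)) := by
  have hex : ∃ p : Fin n × Fin n, (p.2 : ℕ) = p.1 + 1 ∧ β p.1 < β p.2 := ⟨(a, b), hab, h⟩
  obtain ⟨c, d, hcd, hβ, hk⟩ : ∃ c d : Fin n, (d : ℕ) = c + 1 ∧ β c < β d ∧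
      keyPoly β = isobaric c d (keyPoly (β ∘ Equiv.swap c d)) := by
    refine ⟨hex.choose.1, hex.choose.2, hex.choose_spec.1, hex.choose_spec.2, ?_⟩
    rw [keyPoly, dif_pos hex]
  have w1 := weight_swap_lt β a b (by rw [Fin.lt_def]; omega) h
  have w2 := weight_swap_lt β c d (by rw [Fin.lt_def]; omega) hβ
  -- two overlapping ascents `u, u + 1, u + 2`, in either role
  have braid : ∀ u v w : Fin n, (v : ℕ) = u + 1 → (w : ℕ) = v + 1 → β u < β v → β v < β w →
      ∑ i : Fin n, (i : ℕ) * (β ∘ Equiv.swap u v) i < ∑ i : Fin n, (i : ℕ) * β i →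
      ∑ i : Fin n, (i : ℕ) * (β ∘ Equiv.swap v w) i < ∑ i : Fin n, (i : ℕ) * β i →
      isobaric u v (keyPoly (β ∘ Equiv.swap u v)) =
        isobaric v w (keyPoly (β ∘ Equiv.swap v w)) := by
    intro u v w huv hvw h1 h2 l1 l2
    have nuv : u ≠ v := fun e => by rw [Fin.ext_iff] at e; omega
    have nvw : v ≠ w := fun e => by rw [Fin.ext_iff] at e; omega
    have nuw : u ≠ w := fun e => by rw [Fin.ext_iff] at e; omega
    have fw : Equiv.swap u v w = w := Equiv.swap_apply_of_ne_of_ne nuw.symm nvw.symm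
    have fu : Equiv.swap v w u = u := Equiv.swap_apply_of_ne_of_ne nuv nuw
    have luv : u < v := by rw [Fin.lt_def]; omega
    have lvw : v < w := by rw [Fin.lt_def]; omega
    have a1 : (β ∘ Equiv.swap u v) v < (β ∘ Equiv.swap u v) w := by
      simpa [fw] using h1.trans h2
    have b1 : (β ∘ Equiv.swap v w) u < (β ∘ Equiv.swap v w) v := by
      simpa [fu] using h1.trans h2
    have l3 := (weight_swap_lt _ v w lvw a1).trans l1
    have l4 := (weight_swap_lt _ u v luv b1).trans l2
    have a2 : ((β ∘ Equiv.swap u v) ∘ Equiv.swap v w) u <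
        ((β ∘ Equiv.swap u v) ∘ Equiv.swap v w) v := by simpa [fu, fw] using h2
    have b2 : ((β ∘ Equiv.swap v w) ∘ Equiv.swap u v) v <
        ((β ∘ Equiv.swap v w) ∘ Equiv.swap u v) w := by simpa [fu, fw] using h1
    rw [keyPoly_of_ascent (β ∘ Equiv.swap u v) v w hvw a1,
      keyPoly_of_ascent ((β ∘ Equiv.swap u v) ∘ Equiv.swap v w) u v huv a2,
      keyPoly_of_ascent (β ∘ Equiv.swap v w) u v huv b1,
      keyPoly_of_ascent ((β ∘ Equiv.swap v w) ∘ Equiv.swap u v) v w hvw b2,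
      isobaric_braid nuv nuw nvw]
    have e : ((β ∘ Equiv.swap u v) ∘ Equiv.swap v w) ∘ Equiv.swap u v =
        ((β ∘ Equiv.swap v w) ∘ Equiv.swap u v) ∘ Equiv.swap v w :=
      congrArg (fun p : Equiv.Perm (Fin n) => β ∘ p) (swap_braid nuv nuw nvw).symm
    rw [e]
  -- two ascents far apart
  have far : ∀ a b c d : Fin n, (b : ℕ) = a + 1 → (d : ℕ) = c + 1 → β a < β b → β c < β d →
      ∑ i : Fin n, (i : ℕ) * (β ∘ Equiv.swap a b) i < ∑ i : Fin n, (i : ℕ) * β i →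
      ∑ i : Fin n, (i : ℕ) * (β ∘ Equiv.swap c d) i < ∑ i : Fin n, (i : ℕ) * β i →
      (a : ℕ) < c → b ≠ c →
      isobaric c d (keyPoly (β ∘ Equiv.swap c d)) =
        isobaric a b (keyPoly (β ∘ Equiv.swap a b)) := by
    intro a b c d hab hcd h1 h2 l1 l2 hac hbc'
    have hbc : (b : ℕ) ≠ c := fun e => hbc' (Fin.ext e)
    have nab : a ≠ b := fun e => by rw [Fin.ext_iff] at e; omega
    have ncd : c ≠ d := fun e => by rw [Fin.ext_iff] at e; omega
    have nac : a ≠ c := fun e => by rw [Fin.ext_iff] at e; omega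
    have nad : a ≠ d := fun e => by rw [Fin.ext_iff] at e; omega
    have nbd : b ≠ d := fun e => by rw [Fin.ext_iff] at e; omega
    have a1 : (β ∘ Equiv.swap c d) a < (β ∘ Equiv.swap c d) b := by
      simpa [Equiv.swap_apply_of_ne_of_ne nac nad, Equiv.swap_apply_of_ne_of_ne hbc' nbd] using h1
    have b1 : (β ∘ Equiv.swap a b) c < (β ∘ Equiv.swap a b) d := by
      simpa [Equiv.swap_apply_of_ne_of_ne nac.symm hbc'.symm,
        Equiv.swap_apply_of_ne_of_ne nad.symm nbd.symm] using h2
    rw [keyPoly_of_ascent (β ∘ Equiv.swap c d) a b hab a1,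
      keyPoly_of_ascent (β ∘ Equiv.swap a b) c d hcd b1,
      isobaric_comm nab ncd nac nad hbc' nbd]
    have e : (β ∘ Equiv.swap c d) ∘ Equiv.swap a b = (β ∘ Equiv.swap a b) ∘ Equiv.swap c d :=
      congrArg (fun p : Equiv.Perm (Fin n) => β ∘ p) (swap_mul_comm nac nad hbc' nbd).symm
    rw [e]
  rw [hk]
  rcases lt_trichotomy (a : ℕ) c with hac | hac | hac
  · by_cases hbc : b = c
    · subst hbc
      exact (braid a b d hab hcd h hβ w1 w2).symm
    · exact far a b c d hab hcd h hβ w1 w2 hac hbc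
  · obtain rfl : a = c := Fin.ext hac
    obtain rfl : b = d := Fin.ext (by omega)
    rfl
  · by_cases hbc : d = a
    · subst hbc
      exact braid c d b hcd hab hβ h w2 w1
    · exact (far c d a b hcd hab hβ h w2 w1 hac hbc).symm
termination_by ∑ i : Fin n, (i : ℕ) * β i
decreasing_by all_goals assumption

/-- `keyPoly` has the defining properties of the key polynomials. -/
theorem keyPoly_isKeyFamily {n : ℕ} : IsKeyFamily (keyPoly (n := n)) where
  antitone := keyPoly_of_antitone
  step α a b hab h := by
    rw [keyPoly_of_ascent (α ∘ Equiv.swap a b) a b hab (by simpa using h)]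
    congr 2
    funext x
    simp

/-- Partitions of arbitrary size. -/
abbrev Par : Type := Σ n : ℕ, n.Partition

/-- The largest part `λ_1` (and `0` for the empty partition). -/
def Par.largest (lam : Par) : ℕ := lam.2.parts.sup

/-- `λ ∖ {λ_1}`. -/
def Par.removeLargest (lam : Par) : Par :=
  ⟨_, Nat.Partition.ofMultiset (lam.2.parts.erase lam.largest)⟩

/-- `λ ∪ {p}`, for `p > 0`. -/
def Par.insertPart (lam : Par) (p : ℕ) : Par :=
  ⟨_, Nat.Partition.ofMultiset (p ::ₘ lam.2.parts)⟩

/-- Move the largest part of `λ^(i)` into `λ^(j)`, for `i ≠ j`. -/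
def moveLargest {r : ℕ} (lam : Fin r → Par) (i j : Fin r) : Fin r → Par :=
  Function.update (Function.update lam i (lam i).removeLargest) j
    ((lam j).insertPart (lam i).largest)

/-- The composition `0^{n - ℓ(λ)} * rev(λ)` of length `n`, for `n ≥ ℓ(λ)`: its last entry is `λ_1`,
the one before it `λ_2`, and so on. -/
def Par.revPad (lam : Par) (n : ℕ) (k : Fin n) : ℕ :=
  (lam.2.parts.sort (· ≥ ·)).getD (n - 1 - k) 0

/-- Formal power series over `ℚ` in `r` infinite alphabets `X_i = x_{i,0} + x_{i,1} + ⋯`. -/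
abbrev Series (r : ℕ) : Type := MvPowerSeries (Fin r × ℕ) ℚ

/-- The multi-symmetric Schur polynomial in alphabets of sizes `n_1, …, n_r`: the key polynomial of
the concatenation of the compositions `0^{n_i - ℓ(λ^(i))} * rev(λ^(i))`, in the concatenated
variables `x_{1,0}, …, x_{1,n_1-1}, …, x_{r,0}, …, x_{r,n_r-1}`. (`finSigmaFinEquiv` numbers the
pairs `(i, k)` with `k < n_i` in lexicographic order.) -/
noncomputable def multiSchurPoly {r : ℕ} (lam : Fin r → Par) (n : Fin r → ℕ) :
    MvPolynomial (Fin r × ℕ) ℚ :=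
  rename (fun k => ((finSigmaFinEquiv.symm k).1, ((finSigmaFinEquiv.symm k).2 : ℕ)))
    (keyPoly fun k : Fin (∑ i, n i) =>
      (lam (finSigmaFinEquiv.symm k).1).revPad _ (finSigmaFinEquiv.symm k).2)

/-- `F` is the limit of `P n` as all `n_1, …, n_r → ∞`, as formal power series: every coefficient is
eventually constant. -/
def IsStableLimit {r : ℕ} (P : (Fin r → ℕ) → MvPolynomial (Fin r × ℕ) ℚ) (F : Series r) : Prop :=
  ∀ m : (Fin r × ℕ) →₀ ℕ, ∀ᶠ n in Filter.atTop, MvPolynomial.coeff m (P n) = MvPowerSeries.coeff m F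

open Classical in
/-- The multi-symmetric Schur function: the limit of the multi-symmetric Schur polynomials. -/
noncomputable def multiSchur {r : ℕ} (lam : Fin r → Par) : Series r :=
  if h : ∃ F, IsStableLimit (multiSchurPoly lam) F then h.choose else 0

open Classical in
/-- The power sum `p_k(X_i) = ∑_a x_{i,a}^k`, `k ≥ 1`. -/
noncomputable def powerSum {r : ℕ} (i : Fin r) (k : ℕ+) : Series r :=
  fun m => if ∃ a : ℕ, m = Finsupp.single (i, a) (k : ℕ) then 1 else 0

/-- Polynomials in the (algebraically independent) power sums, as power series. -/
noncomputable def ofPowerSums (r : ℕ) : MvPolynomial (Fin r × ℕ+) ℚ →ₐ[ℚ] Series r :=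
  aeval fun q => powerSum q.1 q.2

/-- The ring of multi-symmetric functions `Λ(X_1) ⊗ ⋯ ⊗ Λ(X_r)` over `ℚ`, where
`Λ(X_i) = ℚ[p_1(X_i), p_2(X_i), …]`. -/
noncomputable def MultiSym (r : ℕ) : Subalgebra ℚ (Series r) := (ofPowerSums r).range

/-- Plethystic substitution `f(E_1 | ⋯ | E_r)` of a multi-symmetric function `f`: expand `f` in
power sums and replace `p_k(X_i)` by `E i k = p_k(E_i)`. The expansion of an element of `MultiSym r`
exists by definition and is unique because the power sums are algebraically independent. -/
noncomputable def plethysm {r : ℕ} {A : Type*} [CommRing A] [Algebra ℚ A] (E : Fin r → ℕ+ → A)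
    (f : Series r) : A :=
  aeval (fun q : Fin r × ℕ+ => E q.1 q.2) (Function.invFun (ofPowerSums r) f)

/-- The monomial `z^e` in the Laurent series in `z` over the power series. -/
noncomputable def zPow {r : ℕ} (e : ℤ) : LaurentSeries (Series r) := HahnSeries.single e 1

/-- The alphabets `(… | X_i + z⁻¹ | X_j - z⁻¹ | …)`, for `i ≠ j`: the value of `p_k` on the alphabet
`l`. -/
noncomputable def shift {r : ℕ} (i j : Fin r) (l : Fin r) (k : ℕ+) :
    LaurentSeries (Series r) :=
  HahnSeries.C (powerSum l k) + (if l = i then zPow (-(k : ℤ)) else 0)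
    - (if l = j then zPow (-(k : ℤ)) else 0)

open Classical in
/-- The monomial symmetric function `m_λ(X_i)`: the sum of all monomials in the variables `x_{i,a}`
whose nonzero exponents are the parts of `λ`. -/
noncomputable def monomialSymm {r : ℕ} (i : Fin r) {n : ℕ} (lam : n.Partition) : Series r :=
  fun m => if (∀ v ∈ m.support, v.1 = i) ∧ m.support.val.map m = lam.parts then 1 else 0

/-- The plethystic exponential `Ω(z X_i) = ∑_λ m_λ(z X_i) = ∑_n z^n ∑_{λ ⊢ n} m_λ(X_i)`. -/
noncomputable def omegaZ {r : ℕ} (i : Fin r) : LaurentSeries (Series r) :=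
  HahnSeries.ofPowerSeries ℤ (Series r)
    (PowerSeries.mk fun n => ∑ lam : n.Partition, monomialSymm i lam)

end MultiSchur

open MultiSchur

/-! Everything is proved for finite alphabets. Let p be the largest part in block i. In the exponent
word p stands at the end of block i, immediately before block j. If the last variable of X_i is
counted as the first variable x of X_j, the exponents are unchanged, but block j now reads p
followed by a weakly increasing word. Sorting p into that word costs a composite of operators ξ
along X_j (`keyWord_orderedInsert`): each strict descent is crossed by one ξ, and once p is in place
the remaining ξ act trivially, because a key polynomial is fixed by ξ at a weak ascent
(`isobaric_keyPoly_of_le`).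

Suppose the key polynomial was f(… | X_i | X_j | …), with f a polynomial in power sums. After the
relabelling it is f(… | X_i + x | X_j - x | …). Expanded in powers of x, its coefficients are
symmetric in X_j, so they pass through the sweep (`sweep_mul`), while the sweep turns x^m into
h_m(X_j) (`sweep_X_pow`). The result is `moveOp`, and `Represents.moveOp` is this argument. Pairing
x^m with h_m is taking ⟨z⁰⟩ with x = z⁻¹ against Ω(zX_j) (`ofPowerSums_moveOp`).

The same operation proves that the limit exists and is multi-symmetric. List all parts of all λ^(l)
in decreasing order, one per auxiliary one-variable alphabet, followed by r alphabets with zero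
exponents: the key polynomial is a monomial, hence a product of power sums. Carrying the parts to
their destinations, smallest first, never takes a part past a larger one, and leaves the auxiliary
alphabets empty (`exists_represents`). A polynomial in power sums that gives the key polynomial for
all admissible sizes gives the limit, since evaluation in finite alphabets is truncation of the
power series (`isTruncation_evalPS`). -/

namespace MultiSchur

open MvPolynomial

/-! ### Algebra of the isobaric divided differences. -/

section Isobaric

variable {σ τ : Type*} [DecidableEq σ] [DecidableEq τ] {a b : σ}

theorem isobaric_eq_of_spec (hab : a ≠ b) {f g : MvPolynomial σ ℚ}
    (h : (X a - X b) * g = X a * f - X b * rename (Equiv.swap a b) f) : isobaric a b f = g :=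
  mul_left_cancel₀ (X_sub_ne hab) ((isobaric_spec a b f).trans h.symm)

theorem isobaric_of_rename_swap (hab : a ≠ b) {f : MvPolynomial σ ℚ}
    (h : rename (Equiv.swap a b) f = f) : isobaric a b f = f :=
  isobaric_eq_of_spec hab (by rw [h]; ring)

theorem rename_swap_rename_swap (a b : σ) (f : MvPolynomial σ ℚ) :
    rename (Equiv.swap a b) (rename (Equiv.swap a b) f) = f := by
  rw [rename_rename, ← Equiv.Perm.coe_mul, Equiv.swap_mul_self, Equiv.Perm.coe_one, rename_id_apply]

/-- Numerator and denominator of the divided difference both change sign under the exchange. -/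
theorem rename_swap_isobaric (hab : a ≠ b) (f : MvPolynomial σ ℚ) :
    rename (Equiv.swap a b) (isobaric a b f) = isobaric a b f := by
  have h := isobaric_spec a b f
  have h1 := congrArg (rename (Equiv.swap a b)) h
  simp only [map_mul, map_sub, rename_X, Equiv.swap_apply_left, Equiv.swap_apply_right,
    rename_swap_rename_swap] at h1
  exact mul_left_cancel₀ (X_sub_ne hab) (by linear_combination -h - h1)

theorem isobaric_isobaric (hab : a ≠ b) (f : MvPolynomial σ ℚ) :
    isobaric a b (isobaric a b f) = isobaric a b f :=
  isobaric_of_rename_swap hab (rename_swap_isobaric hab f)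

/-- This linearity over symmetric factors is what later lets coefficients symmetric in X_j pass
through the operators. -/
theorem isobaric_mul (hab : a ≠ b) {g : MvPolynomial σ ℚ} (hg : rename (Equiv.swap a b) g = g)
    (f : MvPolynomial σ ℚ) : isobaric a b (g * f) = g * isobaric a b f := by
  refine isobaric_eq_of_spec hab ?_
  rw [map_mul, hg]
  linear_combination g * isobaric_spec a b f

theorem isobaric_add (hab : a ≠ b) (f g : MvPolynomial σ ℚ) :
    isobaric a b (f + g) = isobaric a b f + isobaric a b g := by
  refine isobaric_eq_of_spec hab ?_
  rw [map_add]
  linear_combination isobaric_spec a b f + isobaric_spec a b g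

theorem isobaric_zero (hab : a ≠ b) : isobaric a b 0 = 0 :=
  isobaric_eq_of_spec hab (by simp)

theorem rename_isobaric (hab : a ≠ b) {v : σ → τ} (hv : Function.Injective v)
    (f : MvPolynomial σ ℚ) :
    rename v (isobaric a b f) = isobaric (v a) (v b) (rename v f) := by
  refine (isobaric_eq_of_spec (hv.ne hab) ?_).symm
  have h := congrArg (rename v) (isobaric_spec a b f)
  simp only [map_mul, map_sub, rename_X] at h
  rw [h, rename_rename, rename_rename]
  congr 4
  funext c
  simp [hv.map_swap]

/-- `ξ_{a,b} x_a^m = h_m(x_a, x_b)`. -/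
theorem isobaric_X_pow (hab : a ≠ b) (m : ℕ) :
    isobaric a b (X a ^ m) = ∑ k ∈ Finset.range (m + 1), (X a : MvPolynomial σ ℚ) ^ k *
      X b ^ (m - k) := by
  refine isobaric_eq_of_spec hab ?_
  have h := (Commute.all (X a : MvPolynomial σ ℚ) (X b)).mul_geom_sum₂ (m + 1)
  simp only [add_tsub_cancel_right] at h
  rw [h]
  simp [pow_succ']

end Isobaric

/-! ### Invariance of key polynomials at weak ascents. -/

/-- Key polynomials are symmetric in adjacent variables whose exponents are equal. -/
theorem isobaric_keyPoly_of_eq {n : ℕ} (β : Fin n → ℕ) (a b : Fin n) (hab : (b : ℕ) = a + 1)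
    (h : β a = β b) : isobaric a b (keyPoly β) = keyPoly β := by
  have nab : a ≠ b := fun e => by rw [Fin.ext_iff] at e; omega
  by_cases hβ : Antitone β
  · rw [keyPoly_of_antitone β hβ]
    refine isobaric_of_rename_swap nab ?_
    rw [rename_monomial]
    refine congrArg (fun m => monomial m (1 : ℚ)) (Finsupp.ext fun c => ?_)
    obtain ⟨c, rfl⟩ := (Equiv.swap a b).surjective c
    rw [Finsupp.mapDomain_apply (Equiv.swap a b).injective]
    simp only [Finsupp.equivFunOnFinite_symm_apply_apply, Equiv.swap_apply_def]
    split_ifs <;> simp_all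
  obtain ⟨c, d, hcd, hlt⟩ := exists_ascent β hβ
  have ncd : c ≠ d := fun e => by rw [Fin.ext_iff] at e; omega
  have lcd : c < d := by rw [Fin.lt_def]; omega
  have w := weight_swap_lt β c d lcd hlt
  by_cases hbc : b = c
  · -- exponents `u, u, v` with `u < v`
    subst hbc
    have nad : a ≠ d := fun e => by rw [Fin.ext_iff] at e; omega
    have fd : Equiv.swap a b d = d := Equiv.swap_apply_of_ne_of_ne nad.symm ncd.symm
    have fa : Equiv.swap b d a = a := Equiv.swap_apply_of_ne_of_ne nab nad
    have h1 : (β ∘ Equiv.swap b d) a < (β ∘ Equiv.swap b d) b := by simpa [fa, h] using hlt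
    have w1 := (weight_swap_lt _ a b (by rw [Fin.lt_def]; omega) h1).trans w
    have ih := isobaric_keyPoly_of_eq ((β ∘ Equiv.swap b d) ∘ Equiv.swap a b) b d hcd
      (by simpa [fa, fd] using h)
    -- By the braid relation ξ_ab ξ_bd ξ_ab = ξ_bd ξ_ab ξ_bd, and the innermost ξ_bd is absorbed by
    -- induction: the exponents are now v, u, u.
    rw [keyPoly_of_ascent β b d hcd hlt, keyPoly_of_ascent (β ∘ Equiv.swap b d) a b hab h1,
      isobaric_braid nab nad ncd, ih]
  by_cases hda : d = a
  · -- exponents `u, v, v` with `u < v`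
    subst hda
    have ncb : c ≠ b := fun e => by rw [Fin.ext_iff] at e; omega
    have fb : Equiv.swap c d b = b := Equiv.swap_apply_of_ne_of_ne ncb.symm nab.symm
    have fc : Equiv.swap d b c = c := Equiv.swap_apply_of_ne_of_ne ncd ncb
    have h1 : (β ∘ Equiv.swap c d) d < (β ∘ Equiv.swap c d) b := by simpa [fb, ← h] using hlt
    have w1 := (weight_swap_lt _ d b (by rw [Fin.lt_def]; omega) h1).trans w
    have ih := isobaric_keyPoly_of_eq ((β ∘ Equiv.swap c d) ∘ Equiv.swap d b) c d hcd
      (by simpa [fb, fc] using h)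
    rw [keyPoly_of_ascent β c d hcd hlt, keyPoly_of_ascent (β ∘ Equiv.swap c d) d b hab h1,
      ← isobaric_braid ncd ncb nab, ih]
  -- The ascent is disjoint from the pair a, b, so the two operators commute.
  · have hac : a ≠ c := by
      rintro rfl
      obtain rfl : b = d := Fin.ext (by omega)
      exact hlt.ne h
    have hbd : b ≠ d := by
      rintro rfl
      exact hac (Fin.ext (by omega))
    have had : a ≠ d := fun e => hda e.symm
    have ih := isobaric_keyPoly_of_eq (β ∘ Equiv.swap c d) a b hab
      (by simpa [Equiv.swap_apply_of_ne_of_ne hac had, Equiv.swap_apply_of_ne_of_ne hbc hbd] using h)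
    rw [keyPoly_of_ascent β c d hcd hlt, isobaric_comm nab ncd hac had hbc hbd, ih]
termination_by ∑ i : Fin n, (i : ℕ) * β i
decreasing_by all_goals assumption

/-- At a strict ascent the key polynomial lies in the image of the idempotent ξ; at equality it is
the preceding symmetry. -/
theorem isobaric_keyPoly_of_le {n : ℕ} (β : Fin n → ℕ) (a b : Fin n) (hab : (b : ℕ) = a + 1)
    (h : β a ≤ β b) : isobaric a b (keyPoly β) = keyPoly β := by
  have nab : a ≠ b := fun e => by rw [Fin.ext_iff] at e; omega
  rcases h.lt_or_eq with h | h
  · rw [keyPoly_of_ascent β a b hab h, isobaric_isobaric nab]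
  · exact isobaric_keyPoly_of_eq β a b hab h

/-! ### Key polynomials of words, and sorting one exponent by a sweep of operators. -/

section KeyWord

variable {σ τ : Type*}

/-- The key polynomial of a word of pairs (variable, exponent). -/
noncomputable def keyWord (l : List (σ × ℕ)) : MvPolynomial σ ℚ :=
  rename (fun k : Fin l.length => l[k].1) (keyPoly fun k => l[k].2)

theorem keyWord_eq {N : ℕ} (l : List (σ × ℕ)) (h : l.length = N) (v : Fin N → σ) (e : Fin N → ℕ)
    (hl : ∀ k : Fin N, l[k] = (v k, e k)) : keyWord l = rename v (keyPoly e) := by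
  subst h
  have hv : v = fun k : Fin l.length => l[k].1 := by funext k; rw [hl]
  have he : e = fun k : Fin l.length => l[k].2 := by funext k; rw [hl]
  rw [hv, he, keyWord]

theorem keyWord_map (g : σ → τ) (l : List (σ × ℕ)) :
    keyWord (l.map (Prod.map g id)) = rename g (keyWord l) := by
  rw [keyWord_eq (N := l.length) _ (by simp) (fun k => g l[k].1) (fun k => l[k].2)
    (fun k => by simp only [Fin.getElem_fin, List.getElem_map]; rfl),
    keyWord, rename_rename]
  rfl

theorem fst_getElem_injective {l : List (σ × ℕ)} (hl : (l.map Prod.fst).Nodup) :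
    Function.Injective (fun k : Fin l.length => l[k].1) := by
  intro j k hjk
  have := (List.Nodup.getElem_inj_iff hl (i := j) (j := k) (hi := by simp) (hj := by simp)).1
    (by simpa using hjk)
  exact Fin.ext this

variable [DecidableEq σ]

/-- The ascent rule transported along the renaming of positions to variables. Distinctness of the
variables makes the renaming injective, so that it commutes with ξ. -/
theorem keyWord_of_lt (A B : List (σ × ℕ)) (x y : σ) (p q : ℕ)
    (hl : ((A ++ (x, p) :: (y, q) :: B).map Prod.fst).Nodup) (hpq : p < q) :
    keyWord (A ++ (x, p) :: (y, q) :: B) =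
      isobaric x y (keyWord (A ++ (x, q) :: (y, p) :: B)) := by
  have inj := fst_getElem_injective hl
  set l := A ++ (x, p) :: (y, q) :: B with hdef
  have hlen : l.length = A.length + (B.length + 2) := by simp [hdef]
  let a : Fin l.length := ⟨A.length, by omega⟩
  let b : Fin l.length := ⟨A.length + 1, by omega⟩
  have ha : l[a] = (x, p) := by simp [a, hdef]
  have hb : l[b] = (y, q) := by simp [b, hdef]
  have nab : a ≠ b := fun e => by simp [a, b, Fin.ext_iff] at e
  have hswap : keyWord (A ++ (x, q) :: (y, p) :: B) =
      rename (fun k : Fin l.length => l[k].1) (keyPoly ((fun k => l[k].2) ∘ Equiv.swap a b)) := by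
    refine keyWord_eq _ (by simp [hdef]) _ _ fun k => ?_
    rcases eq_or_ne k a with rfl | hka
    · simp only [Function.comp_apply, Equiv.swap_apply_left, ha, hb]
      simp [a]
    rcases eq_or_ne k b with rfl | hkb
    · simp only [Function.comp_apply, Equiv.swap_apply_right, ha, hb]
      simp [b]
    · simp only [Function.comp_apply, Equiv.swap_apply_of_ne_of_ne hka hkb]
      have h1 : (k : ℕ) ≠ A.length := fun e => hka (Fin.ext e)
      have h2 : (k : ℕ) ≠ A.length + 1 := fun e => hkb (Fin.ext e)
      simp only [hdef, Fin.getElem_fin, List.getElem_append, List.getElem_cons]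
      split_ifs <;> first | rfl | omega
  rw [hswap, keyWord, keyPoly_of_ascent _ a b rfl (by rw [ha, hb]; exact hpq),
    rename_isobaric nab inj, ha, hb]

theorem isobaric_keyWord_of_le (A B : List (σ × ℕ)) (x y : σ) (p q : ℕ)
    (hl : ((A ++ (x, p) :: (y, q) :: B).map Prod.fst).Nodup) (hpq : p ≤ q) :
    isobaric x y (keyWord (A ++ (x, p) :: (y, q) :: B)) =
      keyWord (A ++ (x, p) :: (y, q) :: B) := by
  have inj := fst_getElem_injective hl
  set l := A ++ (x, p) :: (y, q) :: B with hdef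
  have hlen : l.length = A.length + (B.length + 2) := by simp [hdef]
  let a : Fin l.length := ⟨A.length, by omega⟩
  let b : Fin l.length := ⟨A.length + 1, by omega⟩
  have ha : l[a] = (x, p) := by simp [a, hdef]
  have hb : l[b] = (y, q) := by simp [b, hdef]
  have nab : a ≠ b := fun e => by simp [a, b, Fin.ext_iff] at e
  have h := rename_isobaric nab inj (keyPoly fun k => l[k].2)
  rw [isobaric_keyPoly_of_le _ a b rfl (by rw [ha, hb]; exact hpq)] at h
  simp only [ha, hb] at h
  exact h.symm

/-- The composite `ξ_{y_{N-1}, y_N} ⋯ ξ_{y_1, y_2} ξ_{y_0, y_1}` along a list of variables. -/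
noncomputable def sweep : List σ → MvPolynomial σ ℚ → MvPolynomial σ ℚ
  | x :: y :: ys, f => sweep (y :: ys) (isobaric x y f)
  | _, f => f

theorem sweep_keyWord_of_sorted (A B : List (σ × ℕ)) (ys : List σ) (es : List ℕ)
    (hlen : ys.length = es.length) (hl : ((A ++ ys.zip es ++ B).map Prod.fst).Nodup)
    (hs : es.Pairwise (· ≤ ·)) :
    sweep ys (keyWord (A ++ ys.zip es ++ B)) = keyWord (A ++ ys.zip es ++ B) := by
  induction ys generalizing A es with
  | nil => rfl
  | cons x ys ih =>
    rcases ys with _ | ⟨y, ys⟩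
    · rfl
    rcases es with _ | ⟨p, _ | ⟨q, es⟩⟩
    · simp at hlen
    · simp at hlen
    have e : A ++ (x :: y :: ys).zip (p :: q :: es) ++ B =
        (A ++ [(x, p)]) ++ (y :: ys).zip (q :: es) ++ B := by simp
    have e' : A ++ (x :: y :: ys).zip (p :: q :: es) ++ B =
        A ++ (x, p) :: (y, q) :: (ys.zip es ++ B) := by simp
    have hpq : p ≤ q := by simp only [List.pairwise_cons] at hs; exact hs.1 q (by simp)
    rw [sweep, e', isobaric_keyWord_of_le _ _ _ _ _ _ (e' ▸ hl) hpq, ← e', e]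
    exact ih _ _ (by simpa using hlen) (e ▸ hl) hs.of_cons

/-- Sorting an exponent into a weakly increasing block. -/
theorem keyWord_orderedInsert (A B : List (σ × ℕ)) (y : σ) (ys : List σ) (p : ℕ) (es : List ℕ)
    (hlen : ys.length = es.length)
    (hl : ((A ++ (y :: ys).zip (p :: es) ++ B).map Prod.fst).Nodup)
    (hs : es.Pairwise (· ≤ ·)) :
    keyWord (A ++ (y :: ys).zip (es.orderedInsert (· ≤ ·) p) ++ B) =
      sweep (y :: ys) (keyWord (A ++ (y :: ys).zip (p :: es) ++ B)) := by
  induction ys generalizing A y es with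
  | nil =>
    obtain rfl : es = [] := by simpa using hlen.symm
    rfl
  | cons z ys ih =>
    rcases es with _ | ⟨q, es⟩
    · simp at hlen
    -- If p ≤ q the insertion is over, and the rest of the sweep fixes the sorted word. Otherwise
    -- the first operator exchanges p and q, and the rest inserts p further right.
    by_cases hpq : p ≤ q
    · have hs' : (p :: q :: es).Pairwise (· ≤ ·) := by
        rw [List.pairwise_cons]
        refine ⟨fun a ha => ?_, hs⟩
        rcases List.mem_cons.1 ha with rfl | ha
        · exact hpq
        · exact hpq.trans ((List.pairwise_cons.1 hs).1 a ha)
      rw [List.orderedInsert_cons_of_le _ _ hpq, sweep_keyWord_of_sorted _ _ _ _ (by simpa using hlen)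
        hl hs']
    · rw [List.orderedInsert_of_not_le _ _ hpq, sweep]
      have e : A ++ (y :: z :: ys).zip (q :: es.orderedInsert (· ≤ ·) p) ++ B =
        (A ++ [(y, q)]) ++ (z :: ys).zip (es.orderedInsert (· ≤ ·) p) ++ B := by simp
      have e1 : (A ++ [(y, q)]) ++ (z :: ys).zip (p :: es) ++ B =
        A ++ (y, q) :: (z, p) :: (ys.zip es ++ B) := by simp
      have e2 : A ++ (y :: z :: ys).zip (p :: q :: es) ++ B =
        A ++ (y, p) :: (z, q) :: (ys.zip es ++ B) := by simp
      have hl' : ((A ++ (y, q) :: (z, p) :: (ys.zip es ++ B)).map Prod.fst).Nodup := by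
        rw [e2] at hl; simpa using hl
      rw [e, ih _ _ _ (by simpa using hlen) (e1 ▸ hl') hs.of_cons, e1, e2,
        keyWord_of_lt _ _ _ _ _ _ hl' (not_le.1 hpq)]

theorem sweep_add (ys : List σ) (hys : ys.Nodup) (f g : MvPolynomial σ ℚ) :
    sweep ys (f + g) = sweep ys f + sweep ys g := by
  induction ys generalizing f g with
  | nil => rfl
  | cons x ys ih =>
    rcases ys with _ | ⟨y, ys⟩
    · rfl
    have : x ≠ y := by simp at hys; tauto
    rw [sweep, sweep, sweep, isobaric_add this, ih hys.of_cons]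

theorem sweep_zero (ys : List σ) (hys : ys.Nodup) : sweep ys (0 : MvPolynomial σ ℚ) = 0 := by
  induction ys with
  | nil => rfl
  | cons x ys ih =>
    rcases ys with _ | ⟨y, ys⟩
    · rfl
    have : x ≠ y := by simp at hys; tauto
    rw [sweep, isobaric_zero this, ih hys.of_cons]

theorem sweep_sum {κ : Type*} (ys : List σ) (hys : ys.Nodup) (s : Finset κ)
    (f : κ → MvPolynomial σ ℚ) : sweep ys (∑ k ∈ s, f k) = ∑ k ∈ s, sweep ys (f k) := by
  classical
  induction s using Finset.induction_on with
  | empty => simp [sweep_zero ys hys]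
  | insert k s hk ih => rw [Finset.sum_insert hk, Finset.sum_insert hk, sweep_add ys hys, ih]

theorem sweep_mul (ys : List σ) (hys : ys.Nodup) (g f : MvPolynomial σ ℚ)
    (hg : ∀ x ∈ ys, ∀ y ∈ ys, rename (Equiv.swap x y) g = g) :
    sweep ys (g * f) = g * sweep ys f := by
  induction ys generalizing f with
  | nil => rfl
  | cons x ys ih =>
    rcases ys with _ | ⟨y, ys⟩
    · rfl
    have : x ≠ y := by simp at hys; tauto
    rw [sweep, sweep, isobaric_mul this (hg x (by simp) y (by simp)), ih hys.of_cons]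
    exact fun a ha b hb => hg a (List.mem_cons_of_mem _ ha) b (List.mem_cons_of_mem _ hb)

/-- The complete homogeneous symmetric polynomial `h_m` in a list of variables. -/
noncomputable def complete : List σ → ℕ → MvPolynomial σ ℚ
  | [], m => if m = 0 then 1 else 0
  | y :: ys, m => ∑ k ∈ Finset.range (m + 1), X y ^ k * complete ys (m - k)

/-- The first operator produces the sum of y^k z^{m-k}. The later ones do not involve y, so y^k
factors out, and what remains is the recursion defining `complete`. -/
theorem sweep_X_pow (y : σ) (ys : List σ) (hys : (y :: ys).Nodup) (m : ℕ) :
    sweep (y :: ys) (X y ^ m) = complete (y :: ys) m := by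
  induction ys generalizing y m with
  | nil =>
    rw [sweep, complete, Finset.sum_eq_single_of_mem m (by simp)]
    · simp [complete]
    · intro k hk hkm
      rw [Finset.mem_range] at hk
      rw [complete, if_neg (by omega), mul_zero]
    · simp
  | cons z ys ih =>
    have hyz : y ≠ z := by simp at hys; tauto
    rw [sweep, isobaric_X_pow hyz, sweep_sum _ hys.of_cons, complete]
    refine Finset.sum_congr rfl fun k _ => ?_
    rw [sweep_mul _ hys.of_cons, ih _ hys.of_cons]
    intro a ha b hb
    have hya : y ≠ a := by rintro rfl; exact (List.nodup_cons.1 hys).1 ha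
    have hyb : y ≠ b := by rintro rfl; exact (List.nodup_cons.1 hys).1 hb
    rw [map_pow, rename_X, Equiv.swap_apply_of_ne_of_ne hya hyb]

end KeyWord

/-! ### Symmetric functions as polynomials in power sums, and the operator that moves a part. -/

section PowerSums

variable {σ : Type*}

theorem mk_complete_cons (y : σ) (ys : List σ) :
    PowerSeries.mk (complete (y :: ys)) =
      PowerSeries.mk (fun k => (X y : MvPolynomial σ ℚ) ^ k) * PowerSeries.mk (complete ys) := by
  ext1 m
  rw [PowerSeries.coeff_mul, PowerSeries.coeff_mk, complete,
    Finset.Nat.sum_antidiagonal_eq_sum_range_succ_mk]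
  simp

/-- The logarithmic derivative of the generating function of the `h_m`. -/
theorem derivative_mk_complete (ys : List σ) :
    PowerSeries.derivative (MvPolynomial σ ℚ) (PowerSeries.mk (complete ys)) =
      PowerSeries.mk (fun k => (ys.map fun y => (X y : MvPolynomial σ ℚ) ^ (k + 1)).sum) *
        PowerSeries.mk (complete ys) := by
  induction ys with
  | nil =>
    ext1 m
    rw [PowerSeries.coeff_derivative]
    simp [complete, PowerSeries.coeff_mul]
  | cons y ys ih =>
    have h1 : PowerSeries.derivative (MvPolynomial σ ℚ) (PowerSeries.mk fun k => X y ^ k) =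
        PowerSeries.mk (fun k => (X y : MvPolynomial σ ℚ) ^ (k + 1)) *
          PowerSeries.mk (fun k => X y ^ k) := by
      ext1 m
      rw [PowerSeries.coeff_derivative, PowerSeries.coeff_mul, PowerSeries.coeff_mk,
        Finset.sum_congr rfl (g := fun _ => X y ^ (m + 1)), Finset.sum_const,
        Finset.Nat.card_antidiagonal, nsmul_eq_mul]
      · push_cast; ring
      · intro p hp
        rw [Finset.HasAntidiagonal.mem_antidiagonal] at hp
        rw [PowerSeries.coeff_mk, PowerSeries.coeff_mk, ← pow_add, ← hp]
        congr 1; omega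
    have h2 : (PowerSeries.mk fun k => ((y :: ys).map fun y => (X y : MvPolynomial σ ℚ) ^ (k + 1)).sum)
        = PowerSeries.mk (fun k => X y ^ (k + 1)) +
          PowerSeries.mk (fun k => (ys.map fun y => (X y : MvPolynomial σ ℚ) ^ (k + 1)).sum) := by
      ext1 m; simp
    rw [mk_complete_cons, Derivation.leibniz, ih, h1, h2, smul_eq_mul, smul_eq_mul]
    ring

/-- Newton's identity for complete homogeneous symmetric polynomials. -/
theorem complete_newton (ys : List σ) (m : ℕ) :
    ((m + 1 : ℕ) : MvPolynomial σ ℚ) * complete ys (m + 1) =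
      ∑ k ∈ Finset.range (m + 1),
        (ys.map fun y => (X y : MvPolynomial σ ℚ) ^ (k + 1)).sum * complete ys (m - k) := by
  have h := congrArg (PowerSeries.coeff m) (derivative_mk_complete ys)
  rw [PowerSeries.coeff_derivative, PowerSeries.coeff_mul, PowerSeries.coeff_mk,
    Finset.Nat.sum_antidiagonal_eq_sum_range_succ_mk] at h
  simp only [PowerSeries.coeff_mk] at h
  rw [← h]
  push_cast
  ring

variable {ι : Type*}

/-- Evaluation of a polynomial in the power sums `p_k(X_i)` at finite alphabets of sizes `n_i`. -/
noncomputable def evalPS (n : ι → ℕ) : MvPolynomial (ι × ℕ+) ℚ →ₐ[ℚ] MvPolynomial (ι × ℕ) ℚ :=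
  aeval fun q => ∑ k ∈ Finset.range (n q.1), X (q.1, k) ^ (q.2 : ℕ)

theorem evalPS_X (n : ι → ℕ) (q : ι × ℕ+) :
    evalPS n (X q) = ∑ k ∈ Finset.range (n q.1), X (q.1, k) ^ (q.2 : ℕ) :=
  aeval_X _ _

/-- The complete homogeneous symmetric function `h_m(X_j)` as a polynomial in the power sums. -/
noncomputable def completePS (j : ι) : ℕ → MvPolynomial (ι × ℕ+) ℚ
  | 0 => 1
  | m + 1 => C (((m + 1 : ℕ) : ℚ)⁻¹) * ∑ k : Fin (m + 1), X (j, (k : ℕ).succPNat) *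
      completePS j (m - k)
termination_by m => m
decreasing_by omega

/-- The variables `x_{i,0}, …, x_{i,n-1}`. -/
def alphabet (i : ι) (n : ℕ) : List (ι × ℕ) := (List.range n).map fun k => (i, k)

theorem alphabet_succ (i : ι) (n : ℕ) : alphabet i (n + 1) = alphabet i n ++ [(i, n)] := by
  simp [alphabet, List.range_succ]

theorem alphabet_succ' (i : ι) (n : ℕ) :
    alphabet i (n + 1) = (i, 0) :: (alphabet i n).map fun v => (v.1, v.2 + 1) := by
  simp [alphabet, List.range_succ_eq_map, Function.comp_def]

theorem length_alphabet (i : ι) (n : ℕ) : (alphabet i n).length = n := by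
  simp [alphabet]

theorem mem_alphabet {i : ι} {n : ℕ} {v : ι × ℕ} : v ∈ alphabet i n ↔ v.1 = i ∧ v.2 < n := by
  obtain ⟨a, b⟩ := v
  simp only [alphabet, List.mem_map, List.mem_range, Prod.mk.injEq]
  constructor
  · rintro ⟨k, hk, rfl, rfl⟩; exact ⟨rfl, hk⟩
  · rintro ⟨rfl, h⟩; exact ⟨b, h, rfl, rfl⟩

theorem nodup_alphabet (i : ι) (n : ℕ) : (alphabet i n).Nodup :=
  List.nodup_range.map fun _ _ h => (Prod.mk.inj h).2

theorem complete_zero {σ : Type*} (ys : List σ) : complete ys 0 = 1 := by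
  induction ys with
  | nil => simp [complete]
  | cons y ys ih => simp [complete, ih]

/-- Newton's identity is the recursion that defines `completePS`, and it holds for h_m of a finite
alphabet. -/
theorem evalPS_completePS (n : ι → ℕ) (j : ι) (m : ℕ) :
    evalPS n (completePS j m) = complete (alphabet j (n j)) m := by
  induction m using Nat.strong_induction_on with
  | _ m ih =>
    rcases m with _ | m
    · rw [completePS, map_one, complete_zero]
    have hm : ((m + 1 : ℕ) : ℚ) ≠ 0 := by positivity
    have hN := complete_newton (alphabet j (n j)) m
    have hs : evalPS n (∑ k : Fin (m + 1), X (j, (k : ℕ).succPNat) * completePS j (m - k)) =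
        ((m + 1 : ℕ) : MvPolynomial (ι × ℕ) ℚ) * complete (alphabet j (n j)) (m + 1) := by
      rw [hN, Finset.sum_range, map_sum]
      refine Finset.sum_congr rfl fun k _ => ?_
      rw [map_mul, ih (m - k) (by omega), evalPS_X]
      simp only [alphabet, List.map_map, Function.comp_def, Nat.succPNat_coe, Nat.succ_eq_add_one]
      congr 1
    rw [completePS, map_mul, hs, algHom_C, algebraMap_eq, ← mul_assoc, ← map_natCast C,
      ← C_mul, inv_mul_cancel₀ hm, C_1, one_mul]

variable [DecidableEq ι]

theorem rename_swap_evalPS (n : ι → ℕ) (f : MvPolynomial (ι × ℕ+) ℚ) (j : ι) {v w : ι × ℕ}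
    (hv : v ∈ alphabet j (n j)) (hw : w ∈ alphabet j (n j)) :
    rename (Equiv.swap v w) (evalPS n f) = evalPS n f := by
  obtain ⟨i, a⟩ := v
  obtain ⟨i', b⟩ := w
  rw [mem_alphabet] at hv hw
  obtain ⟨rfl, ha⟩ := hv
  obtain ⟨rfl, hb⟩ := hw
  dsimp only at ha hb
  have : (rename (Equiv.swap (i', a) (i', b))).comp (evalPS n) = evalPS n := by
    refine MvPolynomial.algHom_ext fun q => ?_
    rw [AlgHom.comp_apply, evalPS_X, map_sum]
    simp only [map_pow, rename_X]
    by_cases hq : q.1 = i'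
    · refine Finset.sum_equiv (Equiv.swap a b) (fun k => ?_) fun k _ => ?_
      · simp only [Finset.mem_range, Equiv.swap_apply_def]
        split_ifs <;> simp_all
      · rw [hq]
        congr 2
        simp only [Equiv.swap_apply_def, Prod.mk.injEq, true_and]
        split_ifs <;> rfl
    · refine Finset.sum_congr rfl fun k _ => ?_
      rw [Equiv.swap_apply_of_ne_of_ne] <;> simp [hq]
  exact DFunLike.congr_fun this f

/-- The expansion of `f(… | X_i + w | X_j - w | …)` in powers of a variable `w`. -/
noncomputable def shiftPoly (i j : ι) :
    MvPolynomial (ι × ℕ+) ℚ →ₐ[ℚ] Polynomial (MvPolynomial (ι × ℕ+) ℚ) :=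
  aeval fun q => Polynomial.C (X q) + (if q.1 = i then Polynomial.X ^ (q.2 : ℕ) else 0)
    - (if q.1 = j then Polynomial.X ^ (q.2 : ℕ) else 0)

/-- One formal expansion serves twice: with w a variable of a finite alphabet, and with w = z⁻¹ in
Laurent series. -/
theorem eval₂_shiftPoly {A : Type*} [CommRing A] [Algebra ℚ A] (i j : ι)
    (φ : MvPolynomial (ι × ℕ+) ℚ →ₐ[ℚ] A) (x : A) (f : MvPolynomial (ι × ℕ+) ℚ) :
    Polynomial.eval₂ (φ : MvPolynomial (ι × ℕ+) ℚ →+* A) x (shiftPoly i j f) =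
      aeval (fun q : ι × ℕ+ => φ (X q) + (if q.1 = i then x ^ (q.2 : ℕ) else 0)
        - (if q.1 = j then x ^ (q.2 : ℕ) else 0)) f := by
  induction f using MvPolynomial.induction_on with
  | C a =>
    rw [algHom_C, algHom_C, IsScalarTower.algebraMap_apply ℚ (MvPolynomial (ι × ℕ+) ℚ),
      Polynomial.algebraMap_eq, Polynomial.eval₂_C]
    exact φ.commutes a
  | add f g hf hg => rw [map_add, Polynomial.eval₂_add, hf, hg, map_add]
  | mul_X f q hf =>
    rw [map_mul, Polynomial.eval₂_mul, hf, map_mul, shiftPoly, aeval_X, aeval_X]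
    congr 1
    rw [Polynomial.eval₂_sub, Polynomial.eval₂_add, Polynomial.eval₂_C]
    split_ifs <;> simp

/-- The operator `f ↦ ⟨z⁰⟩ f(… | X_i + z⁻¹ | X_j - z⁻¹ | …) Ω(z X_j)` on polynomials in the power
sums. -/
noncomputable def moveOp (i j : ι) (f : MvPolynomial (ι × ℕ+) ℚ) : MvPolynomial (ι × ℕ+) ℚ :=
  (shiftPoly i j f).sum fun m c => c * completePS j m

end PowerSums

/-! ### Exponent words made of blocks, and moving a part to the next block. -/

section Words

variable {ι : Type*}

/-- The exponents `0^{n - ℓ(s)} * rev(s)`. -/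
def padded (s : Multiset ℕ) (n : ℕ) : List ℕ :=
  (s + Multiset.replicate (n - s.card) 0).sort (· ≤ ·)

theorem length_padded {s : Multiset ℕ} {n : ℕ} (h : s.card ≤ n) : (padded s n).length = n := by
  simp [padded]; omega

theorem pairwise_padded (s : Multiset ℕ) (n : ℕ) : (padded s n).Pairwise (· ≤ ·) :=
  Multiset.pairwise_sort _ _

theorem coe_padded (s : Multiset ℕ) (n : ℕ) :
    (padded s n : Multiset ℕ) = s + Multiset.replicate (n - s.card) 0 :=
  Multiset.sort_eq _ _

theorem eq_padded {s : Multiset ℕ} {n : ℕ} {l : List ℕ} (hl : l.Pairwise (· ≤ ·))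
    (h : (l : Multiset ℕ) = s + Multiset.replicate (n - s.card) 0) : l = padded s n := by
  refine List.Perm.eq_of_pairwise' hl (pairwise_padded s n) ?_
  rw [← Multiset.coe_eq_coe, h, coe_padded]

/-- Length and number of parts both grow by one, so the number of padding zeros is unchanged. -/
theorem orderedInsert_padded (s : Multiset ℕ) (n p : ℕ) :
    (padded s n).orderedInsert (· ≤ ·) p = padded (s + {p}) (n + 1) := by
  refine eq_padded ((pairwise_padded s n).orderedInsert p _) ?_
  rw [Multiset.coe_eq_coe.2 (List.perm_orderedInsert _ p _), ← Multiset.cons_coe, coe_padded]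
  rw [Multiset.card_add, Multiset.card_singleton, Nat.add_sub_add_right, ← Multiset.singleton_add]
  abel

theorem padded_add_of_forall_le {s : Multiset ℕ} {p : ℕ} (n : ℕ) (h : ∀ x ∈ s, x ≤ p) :
    padded (s + {p}) (n + 1) = padded s n ++ [p] := by
  symm
  refine eq_padded ?_ ?_
  · rw [List.pairwise_append]
    refine ⟨pairwise_padded s n, List.pairwise_singleton _ _, fun a ha b hb => ?_⟩
    rw [List.mem_singleton.1 hb]
    rw [← Multiset.mem_coe, coe_padded, Multiset.mem_add] at ha
    rcases ha with ha | ha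
    · exact h a ha
    · rw [Multiset.eq_of_mem_replicate ha]; exact Nat.zero_le _
  · rw [← Multiset.coe_add, coe_padded, Multiset.coe_singleton, Multiset.card_add,
      Multiset.card_singleton, Nat.add_sub_add_right]
    abel

/-- The part of a word that belongs to the alphabet `X_i`. -/
def block (i : ι) (s : Multiset ℕ) (n : ℕ) : List ((ι × ℕ) × ℕ) := (alphabet i n).zip (padded s n)

/-- The concatenation of the blocks with parts `lam i` and sizes `n i`, for `i` in the list `bs`. -/
def word (bs : List ι) (lam : ι → Multiset ℕ) (n : ι → ℕ) : List ((ι × ℕ) × ℕ) :=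
  bs.flatMap fun i => block i (lam i) (n i)

theorem map_fst_block (i : ι) {s : Multiset ℕ} {n : ℕ} (h : s.card ≤ n) :
    (block i s n).map Prod.fst = alphabet i n := by
  rw [block, List.map_fst_zip]
  rw [length_padded h, length_alphabet]

theorem map_fst_word {bs : List ι} {lam : ι → Multiset ℕ} {n : ι → ℕ}
    (h : ∀ l ∈ bs, (lam l).card ≤ n l) :
    (word bs lam n).map Prod.fst = bs.flatMap fun i => alphabet i (n i) := by
  rw [word, List.map_flatMap]
  exact List.flatMap_congr fun i hi => map_fst_block i (h i hi)

theorem nodup_flatMap_alphabet {bs : List ι} (hbs : bs.Nodup) (n : ι → ℕ) :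
    (bs.flatMap fun i => alphabet i (n i)).Nodup := by
  rw [List.nodup_flatMap]
  refine ⟨fun i _ => nodup_alphabet i _, hbs.imp ?_⟩
  intro a b hab v hv hw
  exact hab ((mem_alphabet.1 hv).1.symm.trans (mem_alphabet.1 hw).1)

theorem mem_block {i : ι} {s : Multiset ℕ} {n : ℕ} {v : (ι × ℕ) × ℕ} (h : v ∈ block i s n) :
    v.1.1 = i ∧ v.1.2 < n := by
  obtain ⟨v, e⟩ := v
  exact mem_alphabet.1 (List.of_mem_zip h).1

theorem mem_word {bs : List ι} {lam : ι → Multiset ℕ} {n : ι → ℕ} {v : (ι × ℕ) × ℕ}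
    (h : v ∈ word bs lam n) : v.1.1 ∈ bs := by
  obtain ⟨i, hi, hv⟩ := List.mem_flatMap.1 h
  rwa [(mem_block hv).1]

/-- The polynomial `f` in the power sums represents the key polynomials with parts `lam`, in
alphabets of all admissible sizes; the sizes of the alphabets in `T` are minimal. -/
def Represents (bs : List ι) (T : Set ι) (lam : ι → Multiset ℕ) (f : MvPolynomial (ι × ℕ+) ℚ) :
    Prop :=
  ∀ n : ι → ℕ, (∀ l ∈ bs, (lam l).card ≤ n l) → (∀ l ∈ T, n l = (lam l).card) →
    keyWord (word bs lam n) = evalPS n f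

variable [DecidableEq ι]

/-- Moving a part to the next block. -/
theorem Represents.moveOp {A B : List ι} {i j : ι} {T : Set ι} {lam : ι → Multiset ℕ} {p : ℕ}
    {f : MvPolynomial (ι × ℕ+) ℚ} (hbs : (A ++ i :: j :: B).Nodup)
    (hf : Represents (A ++ i :: j :: B) T (lam + Pi.single i {p}) f) (hp : ∀ x ∈ lam i, x ≤ p) :
    Represents (A ++ i :: j :: B) T (lam + Pi.single j {p}) (moveOp i j f) := by
  intro n hn hT
  have hbs' := hbs
  rw [List.nodup_append] at hbs'
  obtain ⟨-, h2, h3⟩ := hbs'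
  have hij : i ≠ j := by simp at h2; tauto
  have hiA : i ∉ A := fun h => h3 i h i (by simp) rfl
  have hjA : j ∉ A := fun h => h3 j h j (by simp) rfl
  have hiB : i ∉ B := by simp at h2; tauto
  have hjB : j ∉ B := by simp at h2; tauto
  have li : (lam i).card ≤ n i := by simpa [hij] using hn i (by simp)
  obtain ⟨N, hN⟩ : ∃ N, n j = N + 1 := Nat.exists_eq_succ_of_ne_zero (by
    have := hn j (by simp); simp at this; omega)
  have lj : (lam j).card ≤ N := by have := hn j (by simp); simp at this; omega
  -- One variable is lent from X_j to X_i: the hypothesis is applied with sizes n_i + 1 and n_j - 1.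
  -- Minimality on T is preserved, because the numbers of parts change in the same way.
  set n' : ι → ℕ := Function.update (Function.update n j N) i (n i + 1) with hn'
  have n'i : n' i = n i + 1 := by simp [hn']
  have n'j : n' j = N := by simp [hn', hij.symm]
  have n'l : ∀ l, l ≠ i → l ≠ j → n' l = n l := fun l h1 h2 => by simp [hn', h1, h2]
  have hK := hf n' (fun l hl => by
      by_cases h1 : l = i
      · subst h1; simpa [n'i] using li
      by_cases h2 : l = j
      · subst h2; simpa [n'j, h1] using lj
      · simpa [n'l l h1 h2, h1, h2] using hn l hl) (fun l hl => by
      have := hT l hl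
      by_cases h1 : l = i
      · subst h1; simpa [n'i, hij] using this
      by_cases h2 : l = j
      · subst h2
        simp [hN] at this
        simpa [n'j, h1] using this
      · simpa [n'l l h1 h2, h1, h2] using this)
  -- The relabelling: the last variable of the enlarged X_i becomes the first of X_j, and the
  -- variables of the shortened X_j move up by one.
  let ρ : ι × ℕ → ι × ℕ := fun v => if v = (i, n i) then (j, 0) else
    if v.1 = j then (v.1, v.2 + 1) else v
  have ρ_fix : ∀ v : ι × ℕ, v ≠ (i, n i) → v.1 ≠ j → ρ v = v := fun v h1 h2 => by
    simp only [ρ, if_neg h1, if_neg h2]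
  have map_fix : ∀ l : List ((ι × ℕ) × ℕ), (∀ v ∈ l, v.1 ≠ (i, n i) ∧ v.1.1 ≠ j) →
      l.map (Prod.map ρ id) = l := fun l hl => by
    conv_rhs => rw [← List.map_id l]
    refine List.map_congr_left fun v hv => ?_
    simp [Prod.map, ρ_fix v.1 (hl v hv).1 (hl v hv).2]
  set lam₀ := lam + Pi.single i {p} with hlam₀
  set lam' := lam + Pi.single j {p} with hlam'
  have word_eq : ∀ l : List ι, i ∉ l → j ∉ l →
      (word l lam₀ n').map (Prod.map ρ id) = word l lam' n := by
    intro l hi hj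
    have : word l lam₀ n' = word l lam' n := by
      refine List.flatMap_congr fun c hc => ?_
      have h1 : c ≠ i := fun e => hi (e ▸ hc)
      have h2 : c ≠ j := fun e => hj (e ▸ hc)
      simp [hlam', hlam₀, h1, h2, n'l c h1 h2]
    rw [this]
    refine map_fix _ fun v hv => ?_
    have := mem_word hv
    exact ⟨fun e => hi (by rw [e] at this; exact this), fun e => hj (e ▸ this)⟩
  have block_i : (block i (lam₀ i) (n' i)).map (Prod.map ρ id) =
      block i (lam' i) (n i) ++ [((j, 0), p)] := by
    have e1 : lam₀ i = lam i + {p} := by simp [hlam₀]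
    have e2 : lam' i = lam i := by simp [hlam', hij]
    rw [e1, e2, n'i, block, alphabet_succ, padded_add_of_forall_le _ hp, List.zip_append (by
      rw [length_alphabet, length_padded li]), List.map_append]
    congr 1
    · refine map_fix _ fun v hv => ?_
      obtain ⟨h1, h2⟩ := mem_block hv
      refine ⟨fun e => ?_, fun e => hij (h1.symm.trans e)⟩
      rw [e] at h2
      exact lt_irrefl _ h2
    · simp [ρ]
  have block_j : ((j, 0), p) :: (block j (lam₀ j) (n' j)).map (Prod.map ρ id) =
      (alphabet j (n j)).zip (p :: padded (lam j) N) := by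
    have e1 : lam₀ j = lam j := by simp [hlam₀, hij.symm]
    rw [e1, n'j, hN, alphabet_succ', List.zip_cons_cons, List.zip_map_left, block]
    congr 1
    refine List.map_congr_left fun v hv => ?_
    have h1 := (mem_block hv).1
    have h2 : v.1 ≠ (i, n i) := fun e => hij (by rw [← h1, e])
    simp [Prod.map, ρ, h1, h2]
  have word_map : (word (A ++ i :: j :: B) lam₀ n').map (Prod.map ρ id) =
      (word A lam' n ++ block i (lam' i) (n i)) ++ (alphabet j (n j)).zip (p :: padded (lam j) N) ++
        word B lam' n := by
    rw [← block_j, ← word_eq A hiA hjA, ← word_eq B hiB hjB]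
    simp only [word, List.flatMap_append, List.flatMap_cons, List.map_append, block_i]
    simp
  have word_target : word (A ++ i :: j :: B) lam' n =
      (word A lam' n ++ block i (lam' i) (n i)) ++
        (alphabet j (n j)).zip ((padded (lam j) N).orderedInsert (· ≤ ·) p) ++ word B lam' n := by
    have e : lam' j = lam j + {p} := by simp [hlam']
    rw [orderedInsert_padded, ← hN, ← e]
    simp [word, block]
  have hlen : (alphabet j (n j)).length = (p :: padded (lam j) N).length := by
    rw [length_alphabet, List.length_cons, length_padded lj, hN]
  have nodup : (((word A lam' n ++ block i (lam' i) (n i)) ++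
      (alphabet j (n j)).zip (p :: padded (lam j) N) ++ word B lam' n).map Prod.fst).Nodup := by
    have := nodup_flatMap_alphabet hbs n
    rw [← map_fst_word hn, word_target] at this
    simp only [List.map_append] at this ⊢
    rwa [List.map_fst_zip hlen.le, ← List.map_fst_zip (l₁ := alphabet j (n j))
      (l₂ := (padded (lam j) N).orderedInsert (· ≤ ·) p)
      (by rw [hlen, List.orderedInsert_length, List.length_cons])]
  have hsweep : keyWord (word (A ++ i :: j :: B) lam' n) =
      sweep (alphabet j (n j)) (rename ρ (evalPS n' f)) := by
    rw [← hK, ← keyWord_map, word_map, word_target]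
    rw [hN, alphabet_succ'] at hlen nodup ⊢
    exact keyWord_orderedInsert _ _ _ _ _ _ (by simpa using hlen) nodup (pairwise_padded _ _)
  -- In the sizes n, the relabelled alphabets are X_i + x_{j,0} and X_j - x_{j,0}.
  have hshift : rename ρ (evalPS n' f) =
      Polynomial.eval₂ (evalPS n : MvPolynomial (ι × ℕ+) ℚ →+* MvPolynomial (ι × ℕ) ℚ) (X (j, 0))
        (shiftPoly i j f) := by
    rw [eval₂_shiftPoly, ← AlgHom.comp_apply]
    refine DFunLike.congr_fun (MvPolynomial.algHom_ext fun q => ?_) f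
    rw [AlgHom.comp_apply, evalPS_X, aeval_X, map_sum, evalPS_X]
    simp only [map_pow, rename_X]
    obtain ⟨l, k⟩ := q
    by_cases h1 : l = i
    · subst h1
      simp only [n'i, Finset.sum_range_succ, if_true, if_neg hij, sub_zero]
      congr 1
      · refine Finset.sum_congr rfl fun a ha => ?_
        rw [ρ_fix _ _ hij]
        rw [Finset.mem_range] at ha
        simp [ha.ne]
      · simp [ρ]
    by_cases h2 : l = j
    · subst h2
      simp only [n'j, hN, Finset.sum_range_succ', if_true, if_neg h1, add_zero, add_sub_cancel_right]
      refine Finset.sum_congr rfl fun a ha => ?_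
      simp [ρ, h1]
    · simp only [n'l l h1 h2, if_neg h1, if_neg h2, add_zero, sub_zero]
      refine Finset.sum_congr rfl fun a ha => ?_
      rw [ρ_fix _ (by simp [h1]) h2]
  rw [hsweep, hshift, Polynomial.eval₂_eq_sum, Polynomial.sum, sweep_sum _ (nodup_alphabet _ _),
    MultiSchur.moveOp, Polynomial.sum, map_sum]
  refine Finset.sum_congr rfl fun m _ => ?_
  rw [map_mul, evalPS_completePS, RingHom.coe_coe, sweep_mul _ (nodup_alphabet _ _)]
  · congr 1
    have := nodup_alphabet j (n j)
    rw [hN, alphabet_succ'] at this ⊢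
    exact sweep_X_pow _ _ this m
  · exact fun x hx y hy => rename_swap_evalPS n _ j hx hy

end Words

/-! ### Every family of partitions is represented by a polynomial in power sums. -/

theorem keyWord_of_pairwise_ge {σ : Type*} {l : List (σ × ℕ)}
    (h : l.Pairwise fun a b => b.2 ≤ a.2) : keyWord l = (l.map fun v => X v.1 ^ v.2).prod := by
  have anti : Antitone fun k : Fin l.length => l[k].2 := by
    intro a b hab
    rcases hab.lt_or_eq with hab | rfl
    · exact List.pairwise_iff_getElem.1 h a b a.2 b.2 hab
    · exact le_rfl
  rw [keyWord, keyPoly_of_antitone _ anti, monomial_eq, C_1, one_mul, Finsupp.prod_fintype _ _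
    (fun _ => pow_zero _), map_prod]
  simp only [map_pow, rename_X, Finsupp.equivFunOnFinite_symm_apply_apply]
  conv_rhs => rw [← List.ofFn_getElem (xs := l), List.map_ofFn, List.prod_ofFn]
  rfl

theorem padded_zero (n : ℕ) : padded 0 n = List.replicate n 0 :=
  (eq_padded (List.pairwise_replicate.2 (Or.inr le_rfl))
    (by simp [Multiset.coe_replicate])).symm

theorem padded_singleton (p : ℕ) : padded {p} 1 = [p] :=
  (eq_padded (List.pairwise_singleton _ _) (by simp)).symm

theorem zip_replicate_eq_map {α β : Type*} (l : List α) (b : β) :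
    l.zip (List.replicate l.length b) = l.map fun a => (a, b) := by
  induction l with
  | nil => rfl
  | cons a l ih => simp [List.replicate_succ, ih]

theorem sum_single_apply_of_lt (γ : ℕ → ℕ) {t q : ℕ} (h : q < t) :
    (∑ c ∈ Finset.range t, Pi.single c {γ c} : ℕ → Multiset ℕ) q = {γ q} := by
  rw [Finset.sum_apply, Finset.sum_eq_single q]
  · simp
  · intro c _ hc; simp [hc.symm]
  · intro hq; simp [h] at hq

theorem sum_single_apply_of_le (γ : ℕ → ℕ) {t q : ℕ} (h : t ≤ q) :
    (∑ c ∈ Finset.range t, Pi.single c {γ c} : ℕ → Multiset ℕ) q = 0 := by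
  rw [Finset.sum_apply, Finset.sum_eq_zero]
  intro c hc
  rw [Finset.mem_range] at hc
  have : q ≠ c := by omega
  simp [this]

/-- The key polynomial of a partition followed by zeros is a monomial. -/
theorem exists_represents_singles (γ : ℕ → ℕ) (t r : ℕ)
    (hanti : ∀ a b, a ≤ b → b < t → γ b ≤ γ a) (hpos : ∀ q < t, 0 < γ q) :
    ∃ f, Represents (List.range (t + r)) (Set.Iio t)
      (∑ c ∈ Finset.range t, Pi.single c {γ c}) f := by
  -- In a one-variable alphabet the power sum p_γ is the monomial x^γ. Minimality on the first t
  -- alphabets forces them to have size one. Positivity of γ keeps `toPNat'` from returning its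
  -- default value.
  refine ⟨((List.range t).map fun q => X (q, (γ q).toPNat')).prod, fun n _ hT => ?_⟩
  have n1 : ∀ q < t, n q = 1 := fun q hq => by
    rw [hT q hq, sum_single_apply_of_lt γ hq, Multiset.card_singleton]
  have hblock : ∀ q, block q ((∑ c ∈ Finset.range t, Pi.single c {γ c} : ℕ → Multiset ℕ) q) (n q) =
      (alphabet q (n q)).map fun v => (v, if q < t then γ q else 0) := by
    intro q
    split_ifs with hq
    · rw [sum_single_apply_of_lt γ hq, n1 q hq, block, padded_singleton]
      simp [alphabet]
    · rw [sum_single_apply_of_le γ (not_lt.1 hq), block, padded_zero, ← zip_replicate_eq_map,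
        length_alphabet]
  have hsort : (word (List.range (t + r)) (∑ c ∈ Finset.range t, Pi.single c {γ c}) n).Pairwise
      fun a b => b.2 ≤ a.2 := by
    rw [word, List.pairwise_flatMap]
    simp only [hblock]
    refine ⟨fun q _ => ?_, List.pairwise_lt_range.imp fun {a b} hab x hx y hy => ?_⟩
    · rw [List.pairwise_map]
      exact List.pairwise_of_forall fun _ _ => le_rfl
    · obtain ⟨_, _, rfl⟩ := List.mem_map.1 hx
      obtain ⟨_, _, rfl⟩ := List.mem_map.1 hy
      dsimp only
      split_ifs with h1 h2 h2
      · exact hanti a b hab.le h1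
      · omega
      · exact Nat.zero_le _
      · exact le_rfl
  rw [keyWord_of_pairwise_ge hsort, word, List.range_add, List.flatMap_append, List.map_append,
    List.prod_append, map_list_prod, List.map_map]
  simp only [hblock]
  have h1 : (List.range t).flatMap (fun q => (alphabet q (n q)).map fun v =>
      (v, if q < t then γ q else 0)) = (List.range t).map fun q => ((q, 0), γ q) := by
    rw [List.map_eq_flatMap]
    refine List.flatMap_congr fun q hq => ?_
    rw [List.mem_range] at hq
    simp [n1 q hq, hq, alphabet]
  have h2 : ((((List.range r).map (t + ·)).flatMap fun q => (alphabet q (n q)).map fun v =>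
      (v, if q < t then γ q else 0)).map fun v => (X v.1 : MvPolynomial (ℕ × ℕ) ℚ) ^ v.2).prod = 1 := by
    refine List.prod_eq_one fun x hx => ?_
    simp only [List.mem_map, List.mem_flatMap] at hx
    obtain ⟨v, ⟨q, ⟨k, _, rfl⟩, w, _, rfl⟩, rfl⟩ := hx
    simp
  rw [h1, h2, mul_one, List.map_map]
  congr 1
  refine List.map_congr_left fun q hq => ?_
  rw [List.mem_range] at hq
  simp only [Function.comp_apply, evalPS_X, n1 q hq, Finset.sum_range_one]
  rw [Nat.toPNat'_coe, if_pos (hpos q hq)]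

theorem exists_range_eq_append {c M : ℕ} (h : c + 1 < M) :
    ∃ B, List.range M = List.range c ++ c :: (c + 1) :: B := by
  obtain ⟨k, rfl⟩ := Nat.exists_eq_add_of_lt h
  refine ⟨((List.range k).map fun a => c + (a + 1 + 1)), ?_⟩
  rw [show c + 1 + k + 1 = c + (k + 1 + 1) by ring, List.range_add, List.range_succ_eq_map,
    List.range_succ_eq_map]
  simp [Function.comp_def]

/-- A part that is largest in all the blocks it passes can be carried through several blocks. -/
theorem exists_represents_carry {M c d p : ℕ} {T : Set ℕ} {lam : ℕ → Multiset ℕ}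
    (hp : ∀ l, c ≤ l → ∀ x ∈ lam l, x ≤ p) (hcd : c ≤ d) (hd : d < M)
    (h : ∃ f, Represents (List.range M) T (lam + Pi.single c {p}) f) :
    ∃ f, Represents (List.range M) T (lam + Pi.single d {p}) f := by
  induction d, hcd using Nat.le_induction with
  | base => exact h
  | succ d hcd ih =>
    obtain ⟨f, hf⟩ := ih (by omega)
    obtain ⟨B, hB⟩ := exists_range_eq_append hd
    have := List.nodup_range (n := M)
    rw [hB] at hf this ⊢
    exact ⟨_, hf.moveOp this (hp d hcd)⟩

/-- Induction on the number k of parts already delivered, smallest first. When γ_s moves, the larger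
parts wait in alphabets to its left, and everything at or to its right is at most γ_s, as
`exists_represents_carry` requires. -/
theorem exists_represents_distribute (γ d : ℕ → ℕ) (t r : ℕ)
    (hanti : ∀ a b, a ≤ b → b < t → γ b ≤ γ a) (hpos : ∀ q < t, 0 < γ q)
    (hd : ∀ q < t, t ≤ d q ∧ d q < t + r) (k s : ℕ) (hs : s + k = t) :
    ∃ f, Represents (List.range (t + r)) (Set.Iio t)
      (∑ c ∈ Finset.range s, Pi.single c {γ c} + ∑ c ∈ Finset.Ico s t, Pi.single (d c) {γ c}) f := by
  induction k generalizing s with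
  | zero =>
    obtain rfl : s = t := hs
    simpa using exists_represents_singles γ s r hanti hpos
  | succ k ih =>
    have hst : s < t := by omega
    have h := ih (s + 1) (by omega)
    rw [Finset.sum_range_succ, add_right_comm] at h
    rw [Finset.sum_eq_sum_Ico_succ_bot hst, ← add_assoc, add_right_comm]
    refine exists_represents_carry (fun l hl x hx => ?_) (hst.le.trans (hd s hst).1) (hd s hst).2 h
    rw [Pi.add_apply, sum_single_apply_of_le γ hl, zero_add, Finset.sum_apply,
      Multiset.mem_sum] at hx
    obtain ⟨q, hq, hx⟩ := hx
    rw [Finset.mem_Ico] at hq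
    rw [Pi.single_apply] at hx
    split_ifs at hx
    · rw [Multiset.mem_singleton.1 hx]
      exact hanti s q (by omega) hq.2
    · simp at hx

/-- Every family of partitions is distributed from a single weakly decreasing sequence. -/
theorem exists_distribution {r : ℕ} (lam : Fin r → Multiset ℕ) (hpos : ∀ l, ∀ x ∈ lam l, 0 < x) :
    ∃ (t : ℕ) (γ d : ℕ → ℕ), (∀ a b, a ≤ b → b < t → γ b ≤ γ a) ∧ (∀ q < t, 0 < γ q) ∧
      (∀ q < t, t ≤ d q ∧ d q < t + r) ∧
      ∀ l : Fin r, (∑ c ∈ Finset.range t, Pi.single (d c) {γ c} : ℕ → Multiset ℕ) (t + l) = lam l := by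
  classical
  -- All parts, each tagged with its destination; sorting by size gives γ, and the tags give d.
  let M : Multiset (ℕ × Fin r) := ∑ l, (lam l).map fun x => (x, l)
  let R : ℕ × Fin r → ℕ × Fin r → Prop := fun a b => b.1 ≤ a.1
  have : Std.Total R := ⟨fun a b => le_total b.1 a.1⟩
  have : IsTrans (ℕ × Fin r) R := ⟨fun a b c h1 h2 => le_trans h2 h1⟩
  let L := M.toList.insertionSort R
  have hL : (L : Multiset (ℕ × Fin r)) = M := by
    rw [Multiset.coe_eq_coe.2 (List.perm_insertionSort R _), Multiset.coe_toList]
  have hsort : L.Pairwise R := List.pairwise_insertionSort R _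
  refine ⟨L.length, fun q => if h : q < L.length then L[q].1 else 0,
    fun q => if h : q < L.length then L.length + L[q].2 else 0, ?_, ?_, ?_, ?_⟩
  · intro a b hab hb
    dsimp only
    rw [dif_pos hb, dif_pos (hab.trans_lt hb)]
    rcases hab.lt_or_eq with hab | rfl
    · exact List.pairwise_iff_getElem.1 hsort a b _ _ hab
    · exact le_rfl
  · intro q hq
    dsimp only
    rw [dif_pos hq]
    have : L[q] ∈ M := by rw [← hL]; exact List.getElem_mem hq
    simp only [M, Multiset.mem_sum, Multiset.mem_map] at this
    obtain ⟨l, _, x, hx, e⟩ := this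
    rw [← e]
    exact hpos l x hx
  · intro q hq
    dsimp only
    rw [dif_pos hq]
    have := L[q].2.2
    omega
  · intro l
    have h1 : (∑ c ∈ Finset.range L.length, Pi.single
        (if h : c < L.length then L.length + L[c].2 else 0)
        {if h : c < L.length then L[c].1 else 0} : ℕ → Multiset ℕ) (L.length + l) =
        (M.map fun v => if v.2 = l then ({v.1} : Multiset ℕ) else 0).sum := by
      rw [← hL, Multiset.map_coe, Multiset.sum_coe, Finset.sum_apply, Finset.sum_range]
      conv_rhs => rw [← List.ofFn_getElem (xs := L), List.map_ofFn, List.sum_ofFn]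
      refine Finset.sum_congr rfl fun c _ => ?_
      simp only [c.2, dif_pos, Function.comp_apply, Pi.single_apply]
      congr 1
      simp only [Fin.ext_iff, eq_iff_iff]
      omega
    rw [h1]
    simp only [M]
    rw [← Multiset.coe_mapAddMonoidHom, map_sum, ← Multiset.coe_sumAddMonoidHom, map_sum,
      Finset.sum_eq_single l]
    · simp [Multiset.sum_map_singleton]
    · intro c _ hc
      simp [hc]
    · simp

theorem exists_represents {r : ℕ} (lam : Fin r → Multiset ℕ) (hpos : ∀ l, ∀ x ∈ lam l, 0 < x) :
    ∃ f, Represents (List.finRange r) ∅ lam f := by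
  obtain ⟨t, γ, d, hanti, hγ, hd, hlam⟩ := exists_distribution lam hpos
  obtain ⟨f, hf⟩ := exists_represents_distribute γ d t r hanti hγ hd t 0 (zero_add t)
  rw [Finset.sum_range_zero, zero_add, ← Finset.range_eq_Ico] at hf
  set lam' : ℕ → Multiset ℕ := ∑ c ∈ Finset.range t, Pi.single (d c) {γ c}
  have lam'_lt : ∀ q < t, lam' q = 0 := fun q hq => by
    simp only [lam']
    rw [Finset.sum_apply, Finset.sum_eq_zero]
    intro c hc
    have := (hd c (Finset.mem_range.1 hc)).1
    rw [Pi.single_apply, if_neg (by omega)]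
  -- The auxiliary alphabets have become empty, so their power sums are set to zero; the last r
  -- alphabets are renumbered from 0.
  refine ⟨aeval (fun v : ℕ × ℕ+ => if h : t ≤ v.1 ∧ v.1 < t + r then
    X ((⟨v.1 - t, by omega⟩ : Fin r), v.2) else 0) f, fun n hn _ => ?_⟩
  let n' : ℕ → ℕ := fun q => if h : t ≤ q ∧ q < t + r then n ⟨q - t, by omega⟩ else 0
  have n'_lt : ∀ q < t, n' q = 0 := fun q hq => dif_neg (by omega)
  have n'_add : ∀ l : Fin r, n' (t + l) = n l := fun l => by
    simp only [n']
    rw [dif_pos (by omega)]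
    simp
  have hK := hf n' (fun q hq => by
      rw [List.mem_range] at hq
      by_cases h : q < t
      · rw [lam'_lt q h]; simp
      · obtain ⟨l, rfl⟩ := Nat.exists_eq_add_of_le (not_lt.1 h)
        have := hn ⟨l, by omega⟩ (by simp)
        rwa [← hlam, ← n'_add] at this) (fun q hq => by
      rw [lam'_lt q hq, n'_lt q hq]; simp)
  have hword : word (List.range (t + r)) lam' n' =
      (word (List.finRange r) lam n).map (Prod.map (Prod.map (fun l : Fin r => t + (l : ℕ)) id) id) := by
    rw [word, List.range_add, List.flatMap_append, word, List.map_flatMap,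
      List.flatMap_eq_nil_iff.2, List.nil_append, ← List.map_coe_finRange_eq_range, List.map_map,
      List.flatMap_map]
    · refine List.flatMap_congr fun l _ => ?_
      simp only [Function.comp_apply, hlam, n'_add, block]
      rw [← List.zip_map_left]
      simp [alphabet, Function.comp_def]
    · intro q hq
      rw [List.mem_range] at hq
      simp [n'_lt q hq, block, alphabet]
  rw [hword, keyWord_map] at hK
  have h := congrArg (aeval (fun v : ℕ × ℕ => if h : t ≤ v.1 ∧ v.1 < t + r then
    (X ((⟨v.1 - t, by omega⟩ : Fin r), v.2) : MvPolynomial (Fin r × ℕ) ℚ) else 0)) hK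
  rw [aeval_rename] at h
  convert h using 1
  · conv_lhs => rw [← aeval_X_left_apply (R := ℚ) (keyWord (word (List.finRange r) lam n))]
    congr 2
    funext v
    simp
  · rw [← AlgHom.comp_apply, ← AlgHom.comp_apply]
    refine DFunLike.congr_fun (MvPolynomial.algHom_ext fun q => ?_) f
    rw [AlgHom.comp_apply, AlgHom.comp_apply, aeval_X, evalPS_X, map_sum]
    simp only [map_pow, aeval_X]
    by_cases h : t ≤ q.1 ∧ q.1 < t + r
    · simp only [dif_pos h, evalPS_X, n']
    · simp only [dif_neg h, n', map_zero, Finset.sum_range_zero]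

/-! ### Comparison of the defining key polynomial with the key polynomial of a word. -/

section Concatenation

theorem getElem?_flatMap_finRange {α : Type*} {r : ℕ} (n : Fin r → ℕ) (g : Fin r → List α)
    (hg : ∀ i, (g i).length = n i) (i : Fin r) (k : ℕ) (hk : k < n i) :
    ((List.finRange r).flatMap g)[∑ c : Fin i, n (Fin.castLE i.2.le c) + k]? = (g i)[k]? := by
  induction r with
  | zero => exact i.elim0
  | succ r ih =>
    rw [List.finRange_succ, List.flatMap_cons, List.flatMap_map]
    refine Fin.cases (fun hk => ?_) (fun i hk => ?_) i hk
    · have e : ∑ c : Fin ((0 : Fin (r + 1)) : ℕ), n (Fin.castLE (0 : Fin (r + 1)).2.le c) = 0 :=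
        Fintype.sum_empty (ι := Fin 0) _
      rw [e, zero_add, List.getElem?_append_left]
      rwa [hg]
    · have e : ∑ c : Fin (i.succ : Fin (r + 1)), n (Fin.castLE i.succ.2.le c) =
          n 0 + ∑ c : Fin i, n (Fin.castLE i.2.le c).succ :=
        Fin.sum_univ_succ (n := i) fun c => n (Fin.castLE i.succ.2.le c)
      rw [e, add_assoc, List.getElem?_append_right (by rw [hg]; omega), hg, Nat.add_sub_cancel_left]
      exact ih (fun c => n c.succ) (fun c => g c.succ) (fun c => hg c.succ) i hk

theorem padded_eq_append (s : Multiset ℕ) (n : ℕ) :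
    padded s n = List.replicate (n - s.card) 0 ++ (s.sort (· ≥ ·)).reverse := by
  refine (eq_padded ?_ ?_).symm
  · rw [List.pairwise_append]
    refine ⟨List.pairwise_replicate.2 (Or.inr le_rfl), ?_, fun a ha b _ => ?_⟩
    · rw [List.pairwise_reverse]
      exact Multiset.pairwise_sort s (· ≥ ·)
    · rw [List.eq_of_mem_replicate ha]
      exact Nat.zero_le _
  · rw [← Multiset.coe_add, Multiset.coe_reverse, Multiset.sort_eq, Multiset.coe_replicate, add_comm]

theorem getElem?_padded (lam : Par) {n : ℕ} (h : lam.2.parts.card ≤ n) (k : Fin n) :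
    (padded lam.2.parts n)[(k : ℕ)]? = some (lam.revPad n k) := by
  have hk := k.2
  rw [padded_eq_append, Par.revPad]
  by_cases hlt : (k : ℕ) < n - lam.2.parts.card
  · rw [List.getElem?_append_left (by simpa using hlt), List.getElem?_replicate, if_pos hlt,
      List.getD_eq_default]
    rw [Multiset.length_sort]; omega
  · rw [List.getElem?_append_right (by simpa using hlt), List.length_replicate,
      List.getElem?_reverse (by rw [Multiset.length_sort]; omega), Multiset.length_sort,
      List.getD_eq_getElem?_getD, List.getElem?_eq_getElem (by rw [Multiset.length_sort]; omega),
      List.getElem?_eq_getElem (by rw [Multiset.length_sort]; omega), Option.getD_some]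
    congr 2
    omega

theorem length_block {ι : Type*} (i : ι) {s : Multiset ℕ} {n : ℕ} (h : s.card ≤ n) :
    (block i s n).length = n := by
  rw [block, List.length_zip, length_alphabet, length_padded h, min_self]

/-- The sizes must be admissible: in too short an alphabet `revPad` would keep the largest parts,
while zipping with `padded` would keep the smallest. -/
theorem multiSchurPoly_eq_keyWord {r : ℕ} (lam : Fin r → Par) (n : Fin r → ℕ)
    (h : ∀ l, (lam l).2.parts.card ≤ n l) :
    multiSchurPoly lam n = keyWord (word (List.finRange r) (fun l => (lam l).2.parts) n) := by
  have hlen : (word (List.finRange r) (fun l => (lam l).2.parts) n).length = ∑ i, n i := by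
    rw [word, List.length_flatMap]
    simp only [length_block _ (h _)]
    rw [← List.ofFn_eq_map, List.sum_ofFn]
  refine (keyWord_eq _ hlen _ _ fun k => ?_).symm
  obtain ⟨⟨i, k⟩, rfl⟩ := finSigmaFinEquiv.surjective k
  refine List.getElem_eq_iff _ |>.2 ?_
  rw [Equiv.symm_apply_apply, finSigmaFinEquiv_apply, word,
    getElem?_flatMap_finRange n _ (fun i => length_block i (h i)) i k k.2, block,
    List.getElem?_zip_eq_some]
  refine ⟨?_, getElem?_padded (lam i) (h i) k⟩
  simp [alphabet]

end Concatenation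

/-! ### Finite alphabets as truncations of power series, and stable limits. -/

section Truncation

variable {r : ℕ}

open Classical in
/-- `P` is the power series `F` with the variables outside the alphabets of sizes `n` set to zero. -/
def IsTruncation (n : Fin r → ℕ) (P : MvPolynomial (Fin r × ℕ) ℚ) (F : Series r) : Prop :=
  ∀ m, coeff m P = if ∀ v ∈ m.support, v.2 < n v.1 then MvPowerSeries.coeff m F else 0

theorem IsTruncation.add {n : Fin r → ℕ} {P Q : MvPolynomial (Fin r × ℕ) ℚ} {F G : Series r}
    (hP : IsTruncation n P F) (hQ : IsTruncation n Q G) : IsTruncation n (P + Q) (F + G) := by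
  intro m
  rw [coeff_add, hP m, hQ m, map_add]
  split_ifs <;> simp

/-- Exponents add without cancellation, so a product of monomials avoids the discarded variables
exactly when both factors do. -/
theorem IsTruncation.mul {n : Fin r → ℕ} {P Q : MvPolynomial (Fin r × ℕ) ℚ} {F G : Series r}
    (hP : IsTruncation n P F) (hQ : IsTruncation n Q G) : IsTruncation n (P * Q) (F * G) := by
  classical
  intro m
  rw [MvPolynomial.coeff_mul, MvPowerSeries.coeff_mul]
  split_ifs with h
  · refine Finset.sum_congr rfl fun x hx => ?_
    rw [Finset.HasAntidiagonal.mem_antidiagonal] at hx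
    rw [hP, hQ, if_pos, if_pos]
    · exact fun v hv => h v (by rw [← hx]; simp at hv ⊢; omega)
    · exact fun v hv => h v (by rw [← hx]; simp at hv ⊢; omega)
  · refine Finset.sum_eq_zero fun x hx => ?_
    rw [Finset.HasAntidiagonal.mem_antidiagonal] at hx
    push Not at h
    obtain ⟨v, hv, hn⟩ := h
    rw [← hx, Finsupp.mem_support_iff, Finsupp.add_apply] at hv
    by_cases h1 : x.1 v = 0
    · rw [hQ, if_neg, mul_zero]
      exact fun h2 => absurd (h2 v (by rw [Finsupp.mem_support_iff]; omega)) (not_lt.2 hn)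
    · rw [hP, if_neg, zero_mul]
      exact fun h2 => absurd (h2 v (Finsupp.mem_support_iff.2 h1)) (not_lt.2 hn)

theorem isTruncation_C (n : Fin r → ℕ) (a : ℚ) :
    IsTruncation n (C a) (algebraMap ℚ (Series r) a) := by
  classical
  intro m
  rw [coeff_C, MvPowerSeries.algebraMap_apply, MvPowerSeries.coeff_C]
  by_cases hm : m = 0
  · subst hm; simp
  · simp [hm, Ne.symm hm]

theorem isTruncation_powerSum (n : Fin r → ℕ) (i : Fin r) (k : ℕ+) :
    IsTruncation n (∑ a ∈ Finset.range (n i), X (i, a) ^ (k : ℕ)) (powerSum i k) := by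
  classical
  intro m
  rw [coeff_sum]
  simp only [coeff_X_pow]
  change _ = if _ then (if ∃ a : ℕ, m = Finsupp.single (i, a) (k : ℕ) then (1 : ℚ) else 0) else 0
  by_cases hm : ∃ a : ℕ, m = Finsupp.single (i, a) (k : ℕ)
  · obtain ⟨a, rfl⟩ := hm
    have hex : ∃ b : ℕ, Finsupp.single (i, a) (k : ℕ) = Finsupp.single (i, b) (k : ℕ) := ⟨a, rfl⟩
    rw [if_pos hex]
    have e : ∀ b, Finsupp.single (i, b) (k : ℕ) = Finsupp.single (i, a) (k : ℕ) ↔ b = a := by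
      intro b
      rw [Finsupp.single_left_inj k.ne_zero]
      simp
    simp [e]
  · rw [if_neg hm, ite_self]
    refine Finset.sum_eq_zero fun a _ => if_neg fun h => hm ⟨a, h.symm⟩

theorem isTruncation_evalPS (n : Fin r → ℕ) (f : MvPolynomial (Fin r × ℕ+) ℚ) :
    IsTruncation n (evalPS n f) (ofPowerSums r f) := by
  induction f using MvPolynomial.induction_on with
  | C a =>
    rw [algHom_C, algHom_C]
    exact isTruncation_C n a
  | add f g hf hg =>
    rw [map_add, map_add]
    exact hf.add hg
  | mul_X f q hf =>
    rw [map_mul, map_mul, evalPS_X, ofPowerSums, aeval_X]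
    exact hf.mul (isTruncation_powerSum n q.1 q.2)

/-- Used in place of algebraic independence of the power sums: any two expansions of the same series
agree in all finite alphabets. -/
theorem evalPS_eq_of_ofPowerSums_eq {f g : MvPolynomial (Fin r × ℕ+) ℚ}
    (h : ofPowerSums r f = ofPowerSums r g) (n : Fin r → ℕ) : evalPS n f = evalPS n g := by
  ext m
  rw [isTruncation_evalPS n f m, isTruncation_evalPS n g m, h]

/-- Sizes of alphabets that contain all the variables of a monomial. -/
def boxSize (m : (Fin r × ℕ) →₀ ℕ) : Fin r → ℕ := fun _ => m.support.sup fun v => v.2 + 1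

theorem lt_of_boxSize_le {m : (Fin r × ℕ) →₀ ℕ} {n : Fin r → ℕ} (h : boxSize m ≤ n) :
    ∀ v ∈ m.support, v.2 < n v.1 := fun v hv =>
  (Finset.le_sup (f := fun v : Fin r × ℕ => v.2 + 1) hv).trans (h v.1)

theorem coeff_evalPS_of_boxSize_le {m : (Fin r × ℕ) →₀ ℕ} {n : Fin r → ℕ} (h : boxSize m ≤ n)
    (f : MvPolynomial (Fin r × ℕ+) ℚ) :
    coeff m (evalPS n f) = MvPowerSeries.coeff m (ofPowerSums r f) := by
  rw [isTruncation_evalPS n f m, if_pos (lt_of_boxSize_le h)]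

theorem Represents.isStableLimit {lam : Fin r → Par} {f : MvPolynomial (Fin r × ℕ+) ℚ}
    (hf : Represents (List.finRange r) ∅ (fun l => (lam l).2.parts) f) :
    IsStableLimit (multiSchurPoly lam) (ofPowerSums r f) := by
  intro m
  filter_upwards [Filter.eventually_ge_atTop (boxSize m),
    Filter.eventually_ge_atTop fun l => (lam l).2.parts.card] with n h1 h2
  rw [multiSchurPoly_eq_keyWord lam n h2, hf n (fun l _ => h2 l) (by simp),
    coeff_evalPS_of_boxSize_le h1]

theorem IsStableLimit.unique {P : (Fin r → ℕ) → MvPolynomial (Fin r × ℕ) ℚ} {F G : Series r}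
    (hF : IsStableLimit P F) (hG : IsStableLimit P G) : F = G := by
  ext m
  obtain ⟨n, h1, h2⟩ := ((hF m).and (hG m)).exists
  exact h1.symm.trans h2

theorem IsStableLimit.multiSchur_eq {lam : Fin r → Par} {F : Series r}
    (hF : IsStableLimit (multiSchurPoly lam) F) : multiSchur lam = F := by
  have h : ∃ F, IsStableLimit (multiSchurPoly lam) F := ⟨F, hF⟩
  rw [multiSchur, dif_pos h]
  exact h.choose_spec.unique hF

end Truncation

/-! ### Complete homogeneous functions as sums of monomial symmetric functions. -/

section Complete

open Classical in
theorem coeff_complete {σ : Type*} {ys : List σ} (hys : ys.Nodup) (m : ℕ) (μ : σ →₀ ℕ) :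
    coeff μ (complete ys m) = if (∀ v ∈ μ.support, v ∈ ys) ∧ μ.degree = m then 1 else 0 := by
  induction ys generalizing m μ with
  | nil =>
    rw [complete]
    by_cases hμ : μ = 0
    · subst hμ
      by_cases hm : m = 0
      · simp [hm]
      · simp [hm, Ne.symm hm]
    · have h1 : ¬ ∀ v ∈ μ.support, v ∈ ([] : List σ) := by
        intro h
        exact hμ (Finsupp.support_eq_empty.1 (Finset.eq_empty_of_forall_notMem fun v hv => by
          simpa using h v hv))
      have h2 : ¬ ((∀ v ∈ μ.support, v ∈ ([] : List σ)) ∧ μ.degree = m) := fun h => h1 h.1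
      rw [if_neg h2]
      split_ifs
      · rw [coeff_one, if_neg (Ne.symm hμ)]
      · simp
  | cons y ys ih =>
    obtain ⟨hy, hys⟩ := List.nodup_cons.1 hys
    -- Since y does not occur in `ys`, only k = μ y can contribute. The degree is written k + (m -
    -- k) because the claim also covers k > m.
    have term : ∀ k, coeff μ (X y ^ k * complete ys (m - k)) =
        if k = μ y ∧ (∀ v ∈ μ.support, v ∈ y :: ys) ∧ μ.degree = k + (m - k) then (1 : ℚ) else 0 := by
      intro k
      rw [X_pow_eq_monomial, coeff_monomial_mul', one_mul, ih hys]
      by_cases hk : Finsupp.single y k ≤ μ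
      · have hd : μ.degree = k + (μ - Finsupp.single y k).degree := by
          conv_lhs => rw [← add_tsub_cancel_of_le hk]
          rw [map_add, Finsupp.degree_single]
        rw [if_pos hk, hd]
        congr 1
        simp only [eq_iff_iff, Nat.add_left_cancel_iff, ← and_assoc]
        refine and_congr_left fun _ => ?_
        have hky : k ≤ μ y := by simpa using hk y
        constructor
        · intro h
          have e : k = μ y := by
            by_contra hne
            exact hy (h y (by simp; omega))
          refine ⟨e, fun v hv => ?_⟩
          by_cases hvy : v = y
          · simp [hvy]
          · refine List.mem_cons_of_mem _ (h v ?_)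
            rw [Finsupp.mem_support_iff] at hv ⊢
            simpa [Finsupp.single_apply, Ne.symm hvy] using hv
        · rintro ⟨rfl, h⟩ v hv
          rw [Finsupp.mem_support_iff] at hv
          by_cases hvy : v = y
          · subst hvy; simp at hv
          · have := h v (by rw [Finsupp.mem_support_iff]; intro h0; simp [h0] at hv)
            simpa [hvy] using this
      · rw [if_neg hk, if_neg]
        rintro ⟨rfl, -⟩
        exact hk (by simp)
    rw [complete, coeff_sum]
    simp only [term]
    by_cases h : (∀ v ∈ μ.support, v ∈ y :: ys) ∧ μ.degree = m
    · rw [if_pos h]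
      have hle : μ y ≤ m := h.2 ▸ Finsupp.le_degree y μ
      rw [Finset.sum_eq_single_of_mem (μ y) (Finset.mem_range.2 (by omega))]
      · rw [if_pos ⟨rfl, h.1, by omega⟩]
      · intro k _ hk
        rw [if_neg fun h => hk h.1]
    · rw [if_neg h]
      refine Finset.sum_eq_zero fun k hk => if_neg fun h' => h ⟨h'.2.1, ?_⟩
      rw [Finset.mem_range] at hk
      omega

/-- Each monomial of degree m in X_j occurs in exactly one m_λ, the one whose parts are its nonzero
exponents. -/
theorem ofPowerSums_completePS {r : ℕ} (j : Fin r) (m : ℕ) :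
    ofPowerSums r (completePS j m) = ∑ lam : m.Partition, monomialSymm j lam := by
  classical
  ext μ
  rw [← coeff_evalPS_of_boxSize_le le_rfl, evalPS_completePS, coeff_complete (nodup_alphabet _ _),
    map_sum]
  have e : ∀ lam : m.Partition, MvPowerSeries.coeff μ (monomialSymm j lam) =
    if (∀ v ∈ μ.support, v.1 = j) ∧ μ.support.val.map μ = lam.parts then 1 else 0 := fun _ => rfl
  simp only [e]
  have hbox : (∀ v ∈ μ.support, v ∈ alphabet j (boxSize μ j)) ↔ ∀ v ∈ μ.support, v.1 = j := by
    refine forall₂_congr fun v hv => ?_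
    rw [mem_alphabet]
    exact ⟨And.left, fun h => ⟨h, h ▸ lt_of_boxSize_le le_rfl v hv⟩⟩
  have hdeg : (μ.support.val.map μ).sum = μ.degree := rfl
  simp only [hbox]
  by_cases h : (∀ v ∈ μ.support, v.1 = j) ∧ μ.degree = m
  · rw [if_pos h]
    let lam : m.Partition := ⟨μ.support.val.map μ, by
      intro a ha
      obtain ⟨v, hv, rfl⟩ := Multiset.mem_map.1 ha
      exact Nat.pos_of_ne_zero (Finsupp.mem_support_iff.1 hv), hdeg.trans h.2⟩
    rw [Finset.sum_eq_single_of_mem lam (Finset.mem_univ _)]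
    · rw [if_pos ⟨h.1, rfl⟩]
    · intro nu _ hnu
      exact if_neg fun h' => hnu (Nat.Partition.ext h'.2.symm)
  · rw [if_neg h]
    refine (Finset.sum_eq_zero fun lam _ => if_neg fun h' => h ⟨h'.1, ?_⟩).symm
    rw [← hdeg, h'.2, lam.parts_sum]

end Complete

/-! ### The operator on power sums as a constant term in z. -/

section Plethysm

variable {r : ℕ}

theorem ofPowerSums_moveOp (i j : Fin r) (F : Series r) :
    ofPowerSums r (moveOp i j (Function.invFun (ofPowerSums r) F)) =
      (plethysm (shift i j) F * omegaZ j).coeff 0 := by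
  rw [plethysm]
  generalize Function.invFun (ofPowerSums r) F = f
  let φ : MvPolynomial (Fin r × ℕ+) ℚ →ₐ[ℚ] LaurentSeries (Series r) :=
    RingHom.toRatAlgHom (HahnSeries.C.comp (ofPowerSums r : MvPolynomial (Fin r × ℕ+) ℚ →+* Series r))
  have hφ : ∀ g, φ g = HahnSeries.C (ofPowerSums r g) := fun _ => rfl
  have zpow_pow : ∀ k : ℕ, (zPow (-1) : LaurentSeries (Series r)) ^ k = zPow (-(k : ℤ)) := by
    intro k
    rw [zPow, HahnSeries.single_pow, one_pow, zPow]
    simp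
  have h : aeval (fun q : Fin r × ℕ+ => shift i j q.1 q.2) f =
      Polynomial.eval₂ (φ : MvPolynomial (Fin r × ℕ+) ℚ →+* LaurentSeries (Series r)) (zPow (-1))
        (shiftPoly i j f) := by
    rw [eval₂_shiftPoly]
    congr 2
    funext q
    rw [shift, hφ, zpow_pow, ofPowerSums, aeval_X]
  rw [h, Polynomial.eval₂_eq_sum, Polynomial.sum, Finset.sum_mul, HahnSeries.coeff_sum, moveOp,
    Polynomial.sum, map_sum]
  refine Finset.sum_congr rfl fun m _ => ?_
  rw [map_mul, ofPowerSums_completePS, RingHom.coe_coe, hφ, zpow_pow, zPow, HahnSeries.C_apply,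
    HahnSeries.single_mul_single, zero_add, mul_one]
  -- The term c_m z^{-m} picks out the coefficient of z^m in Ω(zX_j), which is h_m(X_j).
  have := HahnSeries.coeff_single_mul_add (r := ofPowerSums r ((shiftPoly i j f).coeff m))
    (x := omegaZ j) (a := (m : ℤ)) (b := -(m : ℤ))
  rw [add_neg_cancel] at this
  rw [this, omegaZ, HahnSeries.ofPowerSeries_apply_coeff, PowerSeries.coeff_mk]

end Plethysm

/-! ### Bookkeeping for removing and inserting the largest part. -/

section Parts

theorem sup_mem_of_ne_zero {s : Multiset ℕ} (hs : s ≠ 0) : s.sup ∈ s := by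
  induction s using Multiset.induction_on with
  | empty => exact absurd rfl hs
  | cons a s ih =>
    rw [Multiset.sup_cons]
    by_cases h : s = 0
    · simp [h]
    · rcases le_total a s.sup with hle | hle
      · rw [sup_eq_right.2 hle]
        exact Multiset.mem_cons_of_mem (ih h)
      · rw [sup_eq_left.2 hle]
        exact Multiset.mem_cons_self _ _

theorem parts_ofMultiset {s : Multiset ℕ} (hs : ∀ x ∈ s, 0 < x) :
    (Nat.Partition.ofMultiset s).parts = s :=
  Multiset.filter_eq_self.2 fun x hx => (hs x hx).ne'

theorem parts_moveLargest {r : ℕ} (lam : Fin r → Par) {i j : Fin r} (hij : i ≠ j)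
    (hne : (lam i).2.parts ≠ 0) :
    (fun l => (moveLargest lam i j l).2.parts) =
      Function.update (fun l => (lam l).2.parts) i ((lam i).2.parts.erase (lam i).largest) +
        Pi.single j {(lam i).largest} := by
  have hmem : (lam i).largest ∈ (lam i).2.parts := sup_mem_of_ne_zero hne
  funext l
  rw [Pi.add_apply, moveLargest]
  by_cases hlj : l = j
  · subst hlj
    rw [Function.update_self, Function.update_of_ne hij.symm, Pi.single_eq_same, Par.insertPart,
      parts_ofMultiset, ← Multiset.singleton_add, add_comm]
    intro x hx
    rcases Multiset.mem_cons.1 hx with rfl | hx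
    · exact (lam i).2.parts_pos hmem
    · exact (lam l).2.parts_pos hx
  · rw [Function.update_of_ne hlj, Pi.single_eq_of_ne hlj, add_zero]
    by_cases hli : l = i
    · subst hli
      rw [Function.update_self, Function.update_self, Par.removeLargest, parts_ofMultiset]
      exact fun x hx => (lam l).2.parts_pos (Multiset.mem_of_mem_erase hx)
    · rw [Function.update_of_ne hli, Function.update_of_ne hli]

theorem parts_eq_update_add_single {r : ℕ} (lam : Fin r → Par) (i : Fin r)
    (hne : (lam i).2.parts ≠ 0) :
    (fun l => (lam l).2.parts) =
      Function.update (fun l => (lam l).2.parts) i ((lam i).2.parts.erase (lam i).largest) +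
        Pi.single i {(lam i).largest} := by
  have hmem : (lam i).largest ∈ (lam i).2.parts := sup_mem_of_ne_zero hne
  funext l
  rw [Pi.add_apply]
  by_cases hli : l = i
  · subst hli
    rw [Function.update_self, Pi.single_eq_same, add_comm, Multiset.singleton_add,
      Multiset.cons_erase hmem]
  · rw [Function.update_of_ne hli, Pi.single_eq_of_ne hli, add_zero]

theorem exists_finRange_eq_append {r : ℕ} {i j : Fin r} (hij : (j : ℕ) = i + 1) :
    ∃ A B, List.finRange r = A ++ i :: j :: B := by
  refine ⟨(List.finRange r).take i, (List.finRange r).drop (j + 1), ?_⟩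
  conv_lhs => rw [← List.take_append_drop i (List.finRange r),
    List.drop_eq_getElem_cons (by simp), List.drop_eq_getElem_cons (by simp; omega)]
  have : (i : ℕ) + 1 = j := hij.symm
  simp [this]

end Parts

end MultiSchur

open MultiSchur
theorem mainTheorem5 {r : ℕ} (lam : Fin r → Par) (i j : Fin r) (hij : (j : ℕ) = i + 1)
    (hne : (lam i).2.parts ≠ 0) :
    IsStableLimit (multiSchurPoly lam) (multiSchur lam) ∧
    IsStableLimit (multiSchurPoly (moveLargest lam i j)) (multiSchur (moveLargest lam i j)) ∧
    multiSchur lam ∈ MultiSym r ∧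
    multiSchur (moveLargest lam i j) =
      (plethysm (shift i j) (multiSchur lam) * omegaZ j).coeff 0 := by
  have nij : i ≠ j := fun e => by rw [Fin.ext_iff] at e; omega
  obtain ⟨f, hf⟩ := exists_represents (fun l => (lam l).2.parts)
    fun l x hx => (lam l).2.parts_pos hx
  have hlim := hf.isStableLimit
  have hF := hlim.multiSchur_eq
  have hmem : multiSchur lam ∈ MultiSym r := ⟨f, hF.symm⟩
  -- The expansion chosen inside `plethysm` is some preimage g of the series, not given as f. It
  -- represents the same key polynomials, so the move is applied to g.
  set g := Function.invFun (ofPowerSums r) (multiSchur lam) with hg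
  have hgF : ofPowerSums r g = ofPowerSums r f := by
    rw [← hF]
    exact Function.invFun_eq (f := ofPowerSums r) ⟨f, hF.symm⟩
  have hgrep : Represents (List.finRange r) ∅ (fun l => (lam l).2.parts) g := fun n h1 h2 => by
    rw [hf n h1 h2, evalPS_eq_of_ofPowerSums_eq hgF]
  have hmove : Represents (List.finRange r) ∅ (fun l => (moveLargest lam i j l).2.parts)
      (moveOp i j g) := by
    obtain ⟨A, B, hAB⟩ := exists_finRange_eq_append hij
    have hnd := List.nodup_finRange r
    rw [parts_eq_update_add_single lam i hne] at hgrep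
    rw [parts_moveLargest lam nij hne]
    rw [hAB] at hgrep hnd ⊢
    -- What remains to be checked is that the parts left in block i do not exceed the one that
    -- moves, which holds because it is the largest.
    refine hgrep.moveOp hnd fun x hx => ?_
    rw [Function.update_self] at hx
    exact Multiset.le_sup (Multiset.mem_of_mem_erase hx)
  have hlim' := hmove.isStableLimit
  refine ⟨hF ▸ hlim, hlim'.multiSchur_eq ▸ hlim', hmem, ?_⟩
  rw [hlim'.multiSchur_eq, ofPowerSums_moveOp i j]
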